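/- Let $\mathbf{Top}$ be a convenient category of spaces; all that is used is that it is a cartesian closed full subcategory of the category of topological spaces which contains the unit interval $I=[0,1]$. Let $\mathcal C$ be a complete, cocomplete and locally small category that is enriched, tensored and cotensored over $\mathbf{Top}$. Write $i_0\colon A\to A\otimes I$ and $p_0\colon Y^I\to Y$ for the maps induced by the endpoint $0\in I$, and $\mathcal C^{\mathbf 2}$ for the category of arrows of $\mathcal C$. For an arrow $f\colon X\to Y$ let $Nf$ be the pullback of $f$ along $p_0\colon Y^I\to Y$, with projections $\phi_f\colon Nf\to X$ and $\chi_f\colon Nf\to Y^I$; let $Ef$ be the pushout of $\phi_f$ along $i_0\colon Nf\to Nf\otimes I$, with coprojection $Lf\colon X\to Ef$; and let $Rf\colon Ef\to Y$ be induced by $f$ and the adjunct $Nf\otimes I\to Y$ of $\chi_f$. Then $N$ and $E$ are functors $\mathcal C^{\mathbf 2}\to\mathcal C$, and $R$ is an endofunctor of $\mathcal C^{\mathbf 2}$ that preserves codomains, pointed by the squares $\eta_f=(Lf,\mathrm{id}_Y)\colon f\to Rf$. For a class $\mathcal M$ of arrows of $\mathcal C$ and a regular cardinal $\alpha$, say that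 a functor $F$ on $\mathcal C^{\mathbf 2}$ *preserves $\alpha$-indexed $\mathcal M$-colimits over a fixed codomain* if, for every $\alpha$-indexed sequence $(f_\beta\colon X_\beta\to Y)_{\beta<\alpha}$ of arrows over a fixed object $Y$ and every cocone $f_\alpha\colon X_\alpha\to Y$ over $Y$ such that $X_\alpha=\operatorname{colim}_{\beta<\alpha}X_\beta$ in $\mathcal C$ with all legs $X_\beta\to X_\alpha$ in $\mathcal M$, the induced cocone exhibits $F f_\alpha$ as $\operatorname{colim}_{\beta<\alpha}F f_\beta$. Let $(\mathcal E,\mathcal M)$ be an orthogonal factorization system on $\mathcal C$ that is well-copowered (each object has, up to isomorphism, only a set of $\mathcal E$-quotients), and assume the *monomorphism hypothesis*: there is a regular cardinal $\alpha$ for which $N$ preserves $\alpha$-indexed $\mathcal M$-colimits over a fixed codomain. Then: 1. For every regular cardinal $\alpha$ for which $N$ preserves $\alpha$-indexed $\mathcal M$-colimits over a fixed codomain, the functors $E$ and $R$ preserve them too. 2. Consequently $R$ satisfies the smallness condition $(\dagger)$ (in its form for endofunctors of $\mathcal C^{\mathbf 2}$ that preserve codomains): there are a well-copowered orthogonal factorization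 system $(\mathcal E',\mathcal M')$ on $\mathcal C$ and a regular cardinal $\alpha$ such that $R$ preserves $\alpha$-indexed $\mathcal M'$-colimits over a fixed codomain. 3. The free monad on the pointed endofunctor $(R,\eta)$ exists constructively. That is, there is a monad $\mathbb F$ on $\mathcal C^{\mathbf 2}$ together with an isomorphism of categories $\mathbf{Alg}_{\mathbb F}\cong\mathbf{Alg}_{R}$ over $\mathcal C^{\mathbf 2}$, where $\mathbf{Alg}_R$ is the category of arrows $g$ with a map $s\colon Rg\to g$ such that $s\,\eta_g=\mathrm{id}$; and for every arrow $f$ the following transfinite sequence of objects $X_\beta$ of $\mathcal C^{\mathbf 2}$ with maps $x_\beta\colon RX_\beta\to X_{\beta+1}$ exists and converges, i.e. for some ordinal $\beta$ all the maps $X_\beta\to X_\gamma$ with $\gamma\ge\beta$ are isomorphisms. One has $X_0=f$, $X_1=Rf$ and $x_0=\mathrm{id}$; the map $X_\beta\to X_{\beta+1}$ is $x_\beta\,\eta_{X_\beta}$; the map $x_{\beta+1}$ is the coequalizer of $\eta_{X_{\beta+1}}x_\beta$ and $R(X_\beta\to X_{\beta+1})$, both $RX_\beta\to RX_{\beta+1}$;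 for a limit ordinal $\lambda$, $X_\lambda=\operatorname{colim}_{\beta<\lambda}X_\beta$, and $x_\lambda$ is the coequalizer of the canonical map $\operatorname{colim}_{\beta<\lambda}RX_\beta\to RX_\lambda$ and the composite of $\operatorname{colim}_{\beta<\lambda}x_\beta\colon\operatorname{colim}_{\beta<\lambda}RX_\beta\to X_\lambda$ with $\eta_{X_\lambda}$. Moreover, for such an ordinal $\beta$ there is an isomorphism $X_\beta\cong\mathbb Ff$ in such a way that the unit $f\to\mathbb Ff$ is $X_0\to X_\beta$ and the $R$-algebra structure on the free algebra $\mathbb Ff$ is $x_\beta$ followed by the inverse of $X_\beta\to X_{\beta+1}$. -/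

import Mathlib

open CategoryTheory Limits MonoidalCategory CartesianMonoidalCategory

universe w v u v' u'

noncomputable section

namespace Hurewicz

/-! ## Tensors and cotensors in an enriched category -/

section Tensors

variable (V : Type u') [Category.{v'} V] [CartesianMonoidalCategory V]
variable (C : Type u) [Category.{v} C] [EnrichedOrdinaryCategory V C]

variable {C} in
lemma eHomEquiv_comp_left {X Y Z : C} (f : X ⟶ Y) (g : Y ⟶ Z) :
    eHomEquiv V (f ≫ g) = eHomEquiv V f ≫ eHomWhiskerLeft V X g := by
  rw [eHomEquiv_comp, eHomWhiskerLeft, MonoidalCategory.tensorHom_def, rightUnitor_inv_naturality_assoc,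
    Category.assoc, unitors_inv_equal]

variable {C} in
lemma eHomEquiv_comp_right {X Y Z : C} (f : X ⟶ Y) (g : Y ⟶ Z) :
    eHomEquiv V (f ≫ g) = eHomEquiv V g ≫ eHomWhiskerRight V f Z := by
  rw [eHomEquiv_comp, eHomWhiskerRight, MonoidalCategory.tensorHom_def', leftUnitor_inv_naturality_assoc,
    Category.assoc]

variable [MonoidalClosed V]

/-- A `V`-category is tensored: for all `X : C` and `K : V` there is an object `X ⊗ K`
with a universal map `K ⟶ C(X, X ⊗ K)`, i.e. one inducing isomorphisms
`C(X ⊗ K, Y) ≅ V(K, C(X, Y))` of objects of `V`. -/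
class Tensored where
  /-- the object `X ⊗ K` -/
  obj : C → V → C
  /-- the universal map `K ⟶ C(X, X ⊗ K)` -/
  unit (X : C) (K : V) : K ⟶ (X ⟶[V] obj X K)
  isIso_curry (X : C) (K : V) (Y : C) :
    IsIso (MonoidalClosed.curry (unit X K ▷ (obj X K ⟶[V] Y) ≫ eComp V X (obj X K) Y))

/-- A `V`-category is cotensored: for all `K : V` and `Y : C` there is an object `Y ^ K`
with a universal map `K ⟶ C(Y ^ K, Y)`, i.e. one inducing isomorphisms
`C(X, Y ^ K) ≅ V(K, C(X, Y))` of objects of `V`. -/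
class Cotensored where
  /-- the object `Y ^ K` -/
  obj : V → C → C
  /-- the universal map `K ⟶ C(Y ^ K, Y)` -/
  counit (K : V) (Y : C) : K ⟶ (obj K Y ⟶[V] Y)
  isIso_curry (K : V) (X Y : C) :
    IsIso (MonoidalClosed.curry
      (lift (snd K (X ⟶[V] obj K Y)) (fst K (X ⟶[V] obj K Y) ≫ counit K Y) ≫
        eComp V X (obj K Y) Y))

variable {V C}

/-- Morphisms `X ⊗ K ⟶ Y` in `C` correspond to morphisms `K ⟶ C(X, Y)` in `V`. -/
def tensorEquiv [Tensored V C] (X : C) (K : V) (Y : C) :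
    (Tensored.obj X K ⟶ Y) ≃ (K ⟶ (X ⟶[V] Y)) :=
  haveI := Tensored.isIso_curry (V := V) X K Y
  (eHomEquiv V).trans <|
    (asIso (MonoidalClosed.curry (Tensored.unit X K ▷ (Tensored.obj X K ⟶[V] Y) ≫
      eComp V X (Tensored.obj X K) Y))).homToEquiv.trans <|
    ((ihom.adjunction K).homEquiv (𝟙_ V) (X ⟶[V] Y)).symm.trans (ρ_ K).homFromEquiv

lemma tensorEquiv_apply [Tensored V C] {X : C} {K : V} {Y : C} (g : Tensored.obj X K ⟶ Y) :
    tensorEquiv X K Y g = Tensored.unit X K ≫ eHomWhiskerLeft V X g := by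
  change (ρ_ K).inv ≫ MonoidalClosed.uncurry (eHomEquiv V g ≫ MonoidalClosed.curry _) = _
  rw [MonoidalClosed.uncurry_natural_left, MonoidalClosed.uncurry_curry,
    whisker_exchange_assoc, eHomWhiskerLeft, rightUnitor_inv_naturality_assoc]

/-- Morphisms `X ⟶ Y ^ K` in `C` correspond to morphisms `K ⟶ C(X, Y)` in `V`. -/
def cotensorEquiv [Cotensored V C] (K : V) (X Y : C) :
    (X ⟶ Cotensored.obj K Y) ≃ (K ⟶ (X ⟶[V] Y)) :=
  haveI := Cotensored.isIso_curry (V := V) K X Y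
  (eHomEquiv V).trans <|
    (asIso (MonoidalClosed.curry
      (lift (snd K (X ⟶[V] Cotensored.obj K Y))
        (fst K (X ⟶[V] Cotensored.obj K Y) ≫ Cotensored.counit K Y) ≫
        eComp V X (Cotensored.obj K Y) Y))).homToEquiv.trans <|
    ((ihom.adjunction K).homEquiv (𝟙_ V) (X ⟶[V] Y)).symm.trans (ρ_ K).homFromEquiv

lemma cotensorEquiv_apply [Cotensored V C] {K : V} {X Y : C} (g : X ⟶ Cotensored.obj K Y) :
    cotensorEquiv K X Y g = Cotensored.counit K Y ≫ eHomWhiskerRight V g Y := by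
  change (ρ_ K).inv ≫ MonoidalClosed.uncurry (eHomEquiv V g ≫ MonoidalClosed.curry _) = _
  rw [MonoidalClosed.uncurry_natural_left, MonoidalClosed.uncurry_curry, eHomWhiskerRight]
  simp only [← Category.assoc]
  congr 1
  apply CartesianMonoidalCategory.hom_ext <;> simp

/-- The map `f ⊗ K : X ⊗ K ⟶ X' ⊗ K` induced by `f : X ⟶ X'`. -/
def tensorMap [Tensored V C] (K : V) {X X' : C} (f : X ⟶ X') :
    Tensored.obj X K ⟶ Tensored.obj X' K :=
  (tensorEquiv X K _).symm (Tensored.unit X' K ≫ eHomWhiskerRight V f (Tensored.obj X' K))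

/-- The map `g ^ K : Y ^ K ⟶ Y' ^ K` induced by `g : Y ⟶ Y'`. -/
def cotensorMap [Cotensored V C] (K : V) {Y Y' : C} (g : Y ⟶ Y') :
    Cotensored.obj K Y ⟶ Cotensored.obj K Y' :=
  (cotensorEquiv K _ Y').symm (Cotensored.counit K Y ≫ eHomWhiskerLeft V (Cotensored.obj K Y) g)

lemma unit_tensorMap [Tensored V C] (K : V) {X X' : C} (f : X ⟶ X') :
    Tensored.unit X K ≫ eHomWhiskerLeft V X (tensorMap K f) =
      Tensored.unit X' K ≫ eHomWhiskerRight V f (Tensored.obj X' K) := by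
  rw [← tensorEquiv_apply, tensorMap, Equiv.apply_symm_apply]

lemma counit_cotensorMap [Cotensored V C] (K : V) {Y Y' : C} (g : Y ⟶ Y') :
    Cotensored.counit K Y' ≫ eHomWhiskerRight V (cotensorMap K g) Y' =
      Cotensored.counit K Y ≫ eHomWhiskerLeft V (Cotensored.obj K Y) g := by
  rw [← cotensorEquiv_apply, cotensorMap, Equiv.apply_symm_apply]

@[simp]
lemma tensorMap_id [Tensored V C] (K : V) (X : C) : tensorMap K (𝟙 X) = 𝟙 (Tensored.obj X K) := by
  apply (tensorEquiv X K _).injective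
  rw [tensorEquiv_apply, tensorEquiv_apply, unit_tensorMap]
  simp

lemma tensorMap_comp [Tensored V C] (K : V) {X X' X'' : C} (f : X ⟶ X') (g : X' ⟶ X'') :
    tensorMap K (f ≫ g) = tensorMap K f ≫ tensorMap K g := by
  apply (tensorEquiv X K _).injective
  rw [tensorEquiv_apply, tensorEquiv_apply, unit_tensorMap, eHomWhiskerLeft_comp,
    ← Category.assoc, unit_tensorMap, Category.assoc, ← eHom_whisker_exchange,
    ← Category.assoc, unit_tensorMap, Category.assoc, eHomWhiskerRight_comp]

@[simp]
lemma cotensorMap_id [Cotensored V C] (K : V) (Y : C) :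
    cotensorMap K (𝟙 Y) = 𝟙 (Cotensored.obj K Y) := by
  apply (cotensorEquiv K _ Y).injective
  rw [cotensorEquiv_apply, cotensorEquiv_apply, counit_cotensorMap]
  simp

lemma cotensorMap_comp [Cotensored V C] (K : V) {Y Y' Y'' : C} (f : Y ⟶ Y') (g : Y' ⟶ Y'') :
    cotensorMap K (f ≫ g) = cotensorMap K f ≫ cotensorMap K g := by
  apply (cotensorEquiv K _ Y'').injective
  rw [cotensorEquiv_apply, cotensorEquiv_apply, counit_cotensorMap, eHomWhiskerRight_comp,
    ← Category.assoc, counit_cotensorMap, Category.assoc, eHom_whisker_exchange,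
    ← Category.assoc, counit_cotensorMap, Category.assoc, eHomWhiskerLeft_comp]

/-- The map `X ⟶ X ⊗ K` induced by a point `t` of `K`. -/
def tensorPoint [Tensored V C] {K : V} (t : 𝟙_ V ⟶ K) (X : C) : X ⟶ Tensored.obj X K :=
  (eHomEquiv V).symm (t ≫ Tensored.unit X K)

/-- The map `Y ^ K ⟶ Y` induced by a point `t` of `K`. -/
def cotensorPoint [Cotensored V C] {K : V} (t : 𝟙_ V ⟶ K) (Y : C) : Cotensored.obj K Y ⟶ Y :=
  (eHomEquiv V).symm (t ≫ Cotensored.counit K Y)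

lemma tensorPoint_naturality [Tensored V C] {K : V} (t : 𝟙_ V ⟶ K) {X X' : C} (f : X ⟶ X') :
    f ≫ tensorPoint t X' = tensorPoint t X ≫ tensorMap K f := by
  apply (eHomEquiv V).injective
  rw [eHomEquiv_comp_right, eHomEquiv_comp_left, tensorPoint, tensorPoint,
    Equiv.apply_symm_apply, Equiv.apply_symm_apply, Category.assoc, Category.assoc,
    unit_tensorMap]

lemma cotensorPoint_naturality [Cotensored V C] {K : V} (t : 𝟙_ V ⟶ K) {Y Y' : C} (g : Y ⟶ Y') :
    cotensorMap K g ≫ cotensorPoint t Y' = cotensorPoint t Y ≫ g := by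
  apply (eHomEquiv V).injective
  rw [eHomEquiv_comp_right, eHomEquiv_comp_left, cotensorPoint, cotensorPoint,
    Equiv.apply_symm_apply, Equiv.apply_symm_apply, Category.assoc, Category.assoc,
    counit_cotensorMap]

/-- The adjunct `X ⊗ K ⟶ Y` of a morphism `X ⟶ Y ^ K`. -/
def adjunct [Tensored V C] [Cotensored V C] {K : V} {X Y : C} (g : X ⟶ Cotensored.obj K Y) :
    Tensored.obj X K ⟶ Y :=
  (tensorEquiv X K Y).symm (cotensorEquiv K X Y g)

lemma unit_adjunct [Tensored V C] [Cotensored V C] {K : V} {X Y : C}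
    (g : X ⟶ Cotensored.obj K Y) :
    Tensored.unit X K ≫ eHomWhiskerLeft V X (adjunct g) =
      Cotensored.counit K Y ≫ eHomWhiskerRight V g Y := by
  rw [← tensorEquiv_apply, adjunct, Equiv.apply_symm_apply, cotensorEquiv_apply]

lemma tensorPoint_adjunct [Tensored V C] [Cotensored V C] {K : V} (t : 𝟙_ V ⟶ K) {X Y : C}
    (g : X ⟶ Cotensored.obj K Y) : tensorPoint t X ≫ adjunct g = g ≫ cotensorPoint t Y := by
  apply (eHomEquiv V).injective
  rw [eHomEquiv_comp_left, eHomEquiv_comp_right, tensorPoint, cotensorPoint,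
    Equiv.apply_symm_apply, Equiv.apply_symm_apply, Category.assoc, Category.assoc, unit_adjunct]

lemma adjunct_naturality [Tensored V C] [Cotensored V C] {K : V} {X X' Y Y' : C}
    (g : X ⟶ Cotensored.obj K Y) (g' : X' ⟶ Cotensored.obj K Y')
    (a : X ⟶ X') (b : Y ⟶ Y') (h : a ≫ g' = g ≫ cotensorMap K b) :
    tensorMap K a ≫ adjunct g' = adjunct g ≫ b := by
  apply (tensorEquiv X K Y').injective
  rw [tensorEquiv_apply, tensorEquiv_apply, eHomWhiskerLeft_comp, ← Category.assoc,
    unit_tensorMap, Category.assoc, ← eHom_whisker_exchange, ← Category.assoc, unit_adjunct,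
    Category.assoc, ← eHomWhiskerRight_comp, h, eHomWhiskerRight_comp, ← Category.assoc,
    counit_cotensorMap, Category.assoc, eHom_whisker_exchange, ← Category.assoc, ← unit_adjunct,
    Category.assoc, eHomWhiskerLeft_comp]

end Tensors

/-! ## Cole's construction

`I` is an object of `V` (the interval) and `t : 𝟙_ V ⟶ I` is a point of it (the endpoint `0`).
-/

section Cole

variable {V : Type u'} [Category.{v'} V] [CartesianMonoidalCategory V] [MonoidalClosed V]
variable (C : Type u) [Category.{v} C] [EnrichedOrdinaryCategory V C]
variable [Cotensored V C]

section MappingPath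

variable [HasPullbacks C] {I : V} (t : 𝟙_ V ⟶ I)

/-- The mapping path space functor: `N f` is the pullback of `f : X ⟶ Y` and `p₀ : Y ^ I ⟶ Y`. -/
def mappingPath : Arrow C ⥤ C where
  obj f := pullback f.hom (cotensorPoint t f.right)
  map a := pullback.map _ _ _ _ a.left (cotensorMap I a.right) a.right
    a.w.symm (cotensorPoint_naturality t a.right).symm
  map_id f := by apply pullback.hom_ext <;> simp
  map_comp a b := by
    apply pullback.hom_ext
    · refine (pullback.lift_fst _ _ _).trans ?_
      rw [Category.assoc, pullback.map, pullback.map, pullback.lift_fst, pullback.lift_fst_assoc,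
        Category.assoc]
      rfl
    · refine (pullback.lift_snd _ _ _).trans ?_
      rw [Category.assoc, pullback.map, pullback.map, pullback.lift_snd, pullback.lift_snd_assoc,
        Category.assoc, ← cotensorMap_comp]
      rfl

variable {C}

/-- The projection `φ_f : N f ⟶ X`. -/
def mappingPathFst (f : Arrow C) : (mappingPath C t).obj f ⟶ f.left :=
  pullback.fst f.hom (cotensorPoint t f.right)

/-- The projection `χ_f : N f ⟶ Y ^ I`. -/
def mappingPathSnd (f : Arrow C) : (mappingPath C t).obj f ⟶ Cotensored.obj I f.right :=
  pullback.snd f.hom (cotensorPoint t f.right)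

lemma mappingPathFst_naturality {f g : Arrow C} (a : f ⟶ g) :
    (mappingPath C t).map a ≫ mappingPathFst t g = mappingPathFst t f ≫ a.left :=
  pullback.lift_fst _ _ _

lemma mappingPathSnd_naturality {f g : Arrow C} (a : f ⟶ g) :
    (mappingPath C t).map a ≫ mappingPathSnd t g =
      mappingPathSnd t f ≫ cotensorMap I a.right :=
  pullback.lift_snd _ _ _

lemma mappingPath_condition [Tensored V C] (f : Arrow C) :
    mappingPathFst t f ≫ f.hom =
      tensorPoint t ((mappingPath C t).obj f) ≫ adjunct (mappingPathSnd t f) := by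
  rw [tensorPoint_adjunct]
  exact pullback.condition

end MappingPath

variable [Tensored V C] [HasPullbacks C] [HasPushouts C] {I : V} (t : 𝟙_ V ⟶ I)

/-- The functor `f ↦ E f`, where `E f` is the pushout of `φ_f : N f ⟶ X` and
`i₀ : N f ⟶ N f ⊗ I`. -/
def coleE : Arrow C ⥤ C where
  obj f := pushout (mappingPathFst t f) (tensorPoint t ((mappingPath C t).obj f))
  map a := pushout.map _ _ _ _ a.left (tensorMap I ((mappingPath C t).map a))
    ((mappingPath C t).map a) (mappingPathFst_naturality t a).symm
    (tensorPoint_naturality t _).symm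
  map_id f := by apply pushout.hom_ext <;> simp
  map_comp a b := by
    apply pushout.hom_ext
    · refine (pushout.inl_desc _ _ _).trans ?_
      rw [pushout.map, pushout.map, pushout.inl_desc_assoc, Category.assoc, pushout.inl_desc]
      exact Category.assoc _ _ _
    · refine (pushout.inr_desc _ _ _).trans ?_
      rw [pushout.map, pushout.map, pushout.inr_desc_assoc, Category.assoc, pushout.inr_desc,
        Functor.map_comp, tensorMap_comp, Category.assoc]

variable {C}

/-- The left factor `L f : X ⟶ E f`. -/
def coleLeft (f : Arrow C) : f.left ⟶ (coleE C t).obj f :=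
  pushout.inl (mappingPathFst t f) (tensorPoint t ((mappingPath C t).obj f))

/-- The right factor `R f : E f ⟶ Y`, induced by `f : X ⟶ Y` and by the adjunct `N f ⊗ I ⟶ Y`
of `χ_f : N f ⟶ Y ^ I`. -/
def coleRight (f : Arrow C) : (coleE C t).obj f ⟶ f.right :=
  pushout.desc f.hom (adjunct (mappingPathSnd t f)) (mappingPath_condition t f)

lemma coleLeft_coleRight (f : Arrow C) : coleLeft t f ≫ coleRight t f = f.hom :=
  pushout.inl_desc _ _ _

lemma coleLeft_naturality {f g : Arrow C} (a : f ⟶ g) :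
    coleLeft t f ≫ (coleE C t).map a = a.left ≫ coleLeft t g :=
  pushout.inl_desc _ _ _

lemma coleRight_naturality {f g : Arrow C} (a : f ⟶ g) :
    (coleE C t).map a ≫ coleRight t g = coleRight t f ≫ a.right := by
  apply pushout.hom_ext
  · have h := congrArg (· ≫ coleRight t g) (coleLeft_naturality t a)
    simp only [Category.assoc, coleLeft_coleRight] at h
    exact h.trans (a.w.trans (pushout.inl_desc_assoc _ _ _ _).symm)
  · simp only [coleE, coleRight, pushout.inr_desc_assoc, pushout.map, Category.assoc,
      pushout.inr_desc]
    exact adjunct_naturality _ _ _ _ (mappingPathSnd_naturality t a)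

variable (C)

/-- The right functor `R` of the factorization `f = R f ∘ L f`. -/
def coleR : Arrow C ⥤ Arrow C where
  obj f := Arrow.mk (coleRight t f)
  map a := Arrow.homMk ((coleE C t).map a) a.right (coleRight_naturality t a)
  map_id f := by ext <;> simp
  map_comp a b := by ext <;> simp

/-- The point of `R`: its component at `f` is the square `(L f, 𝟙) : f ⟶ R f`. -/
def coleUnit : 𝟭 (Arrow C) ⟶ coleR C t where
  app f := Arrow.homMk (coleLeft t f) (𝟙 f.right)
    ((coleLeft_coleRight t f).trans (Category.comp_id _).symm)
  naturality f g a := by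
    ext
    · exact (coleLeft_naturality t a).symm
    · exact (Category.comp_id _).trans (Category.id_comp _).symm

end Cole

/-! ## Factorization systems and smallness -/

section Smallness

variable {C : Type u} [Category.{v} C]

/-- An orthogonal factorization system: a weak factorization system for which the liftings and
the factorizations are unique (the latter up to a unique isomorphism). -/
structure IsOrthogonalFactorizationSystem (E M : MorphismProperty C) : Prop where
  isWeakFactorizationSystem : E.IsWeakFactorizationSystem M
  lift_unique {A B X Y : C} {e : A ⟶ B} {m : X ⟶ Y} (he : E e) (hm : M m) (l l' : B ⟶ X)
    (h₁ : e ≫ l = e ≫ l') (h₂ : l ≫ m = l' ≫ m) : l = l'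
  factorization_unique {X Y Z Z' : C} {e : X ⟶ Z} {m : Z ⟶ Y} {e' : X ⟶ Z'} {m' : Z' ⟶ Y}
    (he : E e) (hm : M m) (he' : E e') (hm' : M m') (h : e ≫ m = e' ≫ m') :
    ∃! i : Z ≅ Z', e ≫ i.hom = e' ∧ i.hom ≫ m' = m

/-- Every object has, up to isomorphism, only a set of `E`-quotients. -/
def IsWellCopowered (E : MorphismProperty C) : Prop :=
  ∀ X : C, ObjectProperty.EssentiallySmall.{v} (fun Q : Under X => E Q.hom)

/-- The inclusion of the category of arrows with codomain `Y` in the category of all arrows. -/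
def overToArrow (Y : C) : Over Y ⥤ Arrow C where
  obj f := Arrow.mk f.hom
  map a := Arrow.homMk a.left (𝟙 Y) (by simp)

/-- `F` sends to colimits the `α`-indexed `M`-colimits over a fixed codomain: if `(f_β)_{β < α}`
is a sequence of arrows `f_β : X_β ⟶ Y` over `Y` and `f_α : X_α ⟶ Y` is a cocone under it for which
`X_α` is the colimit in `C` of the `X_β`, with all legs `X_β ⟶ X_α` in `M`, then `F f_α` is the
colimit of the `F f_β`. -/
def PreservesMColimits {D : Type u'} [Category.{v'} D] (M : MorphismProperty C)
    (α : Cardinal.{v}) (F : Arrow C ⥤ D) : Prop :=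
  ∀ (Y : C) (f : α.ord.ToType ⥤ Over Y) (c : Cocone f),
    Nonempty (IsColimit ((Over.forget Y).mapCocone c)) → (∀ β, M (c.ι.app β).left) →
      Nonempty (IsColimit ((overToArrow Y ⋙ F).mapCocone c))

/-- The monomorphism hypothesis for the class `M` and the mapping path space functor `N`. -/
def MonomorphismHypothesis (M : MorphismProperty C) (N : Arrow C ⥤ C) : Prop :=
  ∃ α : Cardinal.{v}, α.IsRegular ∧ PreservesMColimits M α N

/-- The smallness condition for an endofunctor `R` of the arrow category which preserves
codomains. -/
def SmallnessCondition (R : Arrow C ⥤ Arrow C) : Prop :=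
  ∃ E M : MorphismProperty C, IsOrthogonalFactorizationSystem E M ∧ IsWellCopowered E ∧
    ∃ α : Cardinal.{v}, α.IsRegular ∧ PreservesMColimits M α R

end Smallness

/-! ## Free monads on pointed endofunctors -/

section FreeMonad

variable {D : Type u} [Category.{v} D]

/-- An algebra for the pointed endofunctor `(T, τ)`. -/
structure PointedAlgebra (T : D ⥤ D) (τ : 𝟭 D ⟶ T) where
  /-- the underlying object -/
  carrier : D
  /-- the structure map -/
  str : T.obj carrier ⟶ carrier
  unit : τ.app carrier ≫ str = 𝟙 carrier

namespace PointedAlgebra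

variable {T : D ⥤ D} {τ : 𝟭 D ⟶ T}

/-- A map of algebras for a pointed endofunctor. -/
@[ext]
structure Hom (A B : PointedAlgebra T τ) where
  /-- the underlying morphism -/
  f : A.carrier ⟶ B.carrier
  comm : T.map f ≫ B.str = A.str ≫ f

instance : Category (PointedAlgebra T τ) where
  Hom := Hom
  id A := ⟨𝟙 _, by simp⟩
  comp a b := ⟨a.f ≫ b.f, by rw [T.map_comp, Category.assoc, b.comm, ← Category.assoc, a.comm,
    Category.assoc]⟩
  id_comp a := Hom.ext (Category.id_comp a.f)
  comp_id a := Hom.ext (Category.comp_id a.f)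
  assoc a b c := Hom.ext (Category.assoc a.f b.f c.f)

variable (T τ) in
/-- The forgetful functor. -/
def forget : PointedAlgebra T τ ⥤ D where
  obj A := A.carrier
  map a := a.f

end PointedAlgebra

/-- An algebraically free monad on `(T, τ)`: a monad together with an isomorphism, over `D`,
of its category of algebras with the category of `(T, τ)`-algebras. -/
structure FreeMonad (T : D ⥤ D) (τ : 𝟭 D ⟶ T) where
  /-- the monad -/
  monad : Monad D
  /-- the isomorphism of categories -/
  toPointed : monad.Algebra ⥤ PointedAlgebra T τ
  /-- its inverse -/
  ofPointed : PointedAlgebra T τ ⥤ monad.Algebra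
  toPointed_ofPointed : toPointed ⋙ ofPointed = 𝟭 _
  ofPointed_toPointed : ofPointed ⋙ toPointed = 𝟭 _
  toPointed_forget : toPointed ⋙ PointedAlgebra.forget T τ = monad.forget

/-- Kelly's transfinite sequence generated by an object `A` and the pointed endofunctor `(T, τ)`,
characterized (up to unique isomorphism) by its construction:

* `X 0 = A`, and `X λ = colim_{β < λ} X β` for `λ` a limit ordinal;
* `x β : T (X β) ⟶ X (β + 1)` is an isomorphism for `β = 0`; for `β + 1` it is the coequalizer of
  `T (X β) ⟶ X (β + 1) ⟶ T (X (β + 1))` (that is `x β` followed by `τ`) and the image under `T` of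
  the map `X β ⟶ X (β + 1)`; for a limit ordinal `λ` it is the coequalizer of the two maps
  `colim_{β < λ} T (X β) ⟶ T (X λ)` of which the first is the canonical comparison, and the
  second is `colim_{β < λ} x β` followed by `τ`;
* the map `X β ⟶ X (β + 1)` is `τ` followed by `x β`. -/
structure FreeAlgebraSequence (T : D ⥤ D) (τ : 𝟭 D ⟶ T) (A : D) where
  /-- the sequence of objects, with its connecting maps -/
  X : Ordinal.{v} ⥤ D
  /-- the maps `T (X β) ⟶ X (β + 1)` -/
  x (β : Ordinal.{v}) : T.obj (X.obj β) ⟶ X.obj (Order.succ β)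
  /-- the sequence starts at `A` -/
  zero : A ≅ X.obj 0
  unit_x (β : Ordinal.{v}) : τ.app (X.obj β) ≫ x β = X.map (homOfLE (Order.le_succ β))
  isIso_x_zero : IsIso (x 0)
  condition_succ (β : Ordinal.{v}) :
    (x β ≫ τ.app (X.obj (Order.succ β))) ≫ x (Order.succ β) =
      T.map (X.map (homOfLE (Order.le_succ β))) ≫ x (Order.succ β)
  isColimit_succ (β : Ordinal.{v}) :
    Nonempty (IsColimit (Cofork.ofπ (x (Order.succ β)) (condition_succ β)))
  isWellOrderContinuous : X.IsWellOrderContinuous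
  /-- for a limit ordinal `l`, a map out of `colim_{β < l} T (X β)` is given by its components -/
  condition_limit (l : Ordinal.{v}) (hl : Order.IsSuccLimit l) (β : Ordinal.{v}) (hβ : β < l) :
    T.map (X.map (homOfLE hβ.le)) ≫ x l =
      (x β ≫ X.map (homOfLE (Order.succ_le_of_lt hβ)) ≫ τ.app (X.obj l)) ≫ x l
  existsUnique_limit (l : Ordinal.{v}) (hl : Order.IsSuccLimit l) {Z : D}
    (h : T.obj (X.obj l) ⟶ Z)
    (w : ∀ (β : Ordinal.{v}) (hβ : β < l), T.map (X.map (homOfLE hβ.le)) ≫ h =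
      (x β ≫ X.map (homOfLE (Order.succ_le_of_lt hβ)) ≫ τ.app (X.obj l)) ≫ h) :
    ∃! k : X.obj (Order.succ l) ⟶ Z, x l ≫ k = h

/-- The sequence converges at `β`: it is stationary from `β` on. -/
def FreeAlgebraSequence.ConvergesAt {T : D ⥤ D} {τ : 𝟭 D ⟶ T} {A : D}
    (S : FreeAlgebraSequence T τ A) (β : Ordinal.{v}) : Prop :=
  ∀ (γ : Ordinal.{v}) (h : β ≤ γ), IsIso (S.X.map (homOfLE h))

/-- The free monad `F` on `(T, τ)` exists constructively: for every object `A` Kelly's transfinite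
sequence exists and converges, at some ordinal `β`, and its value `X β` is the free
algebra `F A`: the unit `A ⟶ F A` is the map `A = X 0 ⟶ X β`, and the `(T, τ)`-algebra structure
of the free algebra `F A` is the composite of `x β : T (X β) ⟶ X (β + 1)` with the inverse
of `X β ⟶ X (β + 1)`. -/
def FreeMonadExistsConstructively (T : D ⥤ D) (τ : 𝟭 D ⟶ T) : Prop :=
  ∃ F : FreeMonad T τ, ∀ A : D, ∃ (S : FreeAlgebraSequence T τ A) (β : Ordinal.{v}),
    S.ConvergesAt β ∧
    ∃ e : S.X.obj β ≅ (F.toPointed.obj (F.monad.free.obj A)).carrier,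
      S.zero.hom ≫ S.X.map (homOfLE (zero_le : 0 ≤ β)) ≫ e.hom =
        F.monad.η.app A ≫
          eqToHom (Functor.congr_obj F.toPointed_forget (F.monad.free.obj A)).symm ∧
      S.x β = T.map e.hom ≫ (F.toPointed.obj (F.monad.free.obj A)).str ≫ e.inv ≫
        S.X.map (homOfLE (Order.le_succ β))

end FreeMonad

/-! ## Spaces -/

section Spaces

variable (P : ObjectProperty TopCat.{w}) (hI : P TopCat.I)

/-- The unit interval, in a full subcategory of the category of topological spaces. -/
def interval : P.FullSubcategory := ⟨TopCat.I, hI⟩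

/-- The endpoint `0` of the unit interval. -/
def intervalZero [CartesianMonoidalCategory P.FullSubcategory] :
    𝟙_ P.FullSubcategory ⟶ interval P hI :=
  ObjectProperty.homMk (TopCat.ofHom (ContinuousMap.const _ (TopCat.I.homeomorph.symm 0)))

end Spaces

end Hurewicz

end

/-!
A pushout commutes with colimits, and so does `- ⊗ I`, being a left adjoint; hence `E`, and with
it `R`, preserves whatever colimits over a fixed codomain are preserved by `N`.

Now let `T` preserve codomains and `α`-indexed `M`-colimits over a fixed codomain. Kelly's sequence
is stationary at a limit ordinal `l` as soon as `T` preserves the colimit `X l` of the earlier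
stages, since the structure maps `T (X β) ⟶ X (β + 1)` then glue to an algebra structure on `X l`.
To find such an `l`, observe that the `E`-quotients of `X β` through which the maps `X β ⟶ X δ`
factor form a small family, so that the image of `X β` is the same in all late enough stages, and
already embeds in one of them. Hence there is an `α`-indexed chain of stages, with colimit `X l`,
which interleaves with the chain of its images in `X l`. The two chains have the same colimit, and
so have the two chains obtained by applying `T`; but the second one is an `M`-colimit.

For existence, the maps `T A ⟶ B` and `A ⟶ B` in Kelly's sequence form a chain of objects of a comma
category, in which each stage is determined by the previous ones, and this structure is iterated
along all ordinals. Finally, an algebra structure on `B` is the same thing as an extension property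
of `B` along the successor maps, so the stable value of the sequence is the free algebra.
-/

noncomputable section

namespace Hurewicz

/-! ## Transfinite sequences -/

section Sequences

variable {K : Type u} [Category.{v} K] {J : Type w}

section Limits

variable [PartialOrder J] (F : J ⥤ K) [F.IsWellOrderContinuous] {l : J}
  (hl : Order.IsSuccLimit l) {Z : K}

include hl

lemma hom_ext_of_isSuccLimit {f g : F.obj l ⟶ Z}
    (h : ∀ (i : J) (hi : i < l), F.map (homOfLE hi.le) ≫ f = F.map (homOfLE hi.le) ≫ g) :
    f = g :=
  (F.isColimitOfIsWellOrderContinuous l hl).hom_ext fun i => h i.1 i.2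

lemma existsUnique_desc_of_isSuccLimit (s : ∀ i < l, F.obj i ⟶ Z)
    (hs : ∀ (i j : J) (hij : i ≤ j) (hj : j < l),
      F.map (homOfLE hij) ≫ s j hj = s i (hij.trans_lt hj)) :
    ∃! d : F.obj l ⟶ Z, ∀ (i : J) (hi : i < l), F.map (homOfLE hi.le) ≫ d = s i hi := by
  let c : Cocone ((Set.principalSegIio l).monotone.functor ⋙ F) :=
    { pt := Z
      ι :=
        { app i := s i.1 i.2
          naturality i j f := (hs i.1 j.1 (leOfHom f) j.2).trans (Category.comp_id _).symm } }
  have hF := F.isColimitOfIsWellOrderContinuous l hl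
  refine ⟨hF.desc c, fun i hi => hF.fac c ⟨i, hi⟩, fun d hd => ?_⟩
  exact hom_ext_of_isSuccLimit F hl fun i hi => (hd i hi).trans (hF.fac c ⟨i, hi⟩).symm

end Limits

lemma map_mem_of_map_succ_mem [LinearOrder J] [SuccOrder J] [WellFoundedLT J]
    (W : MorphismProperty K) [MorphismProperty.IsStableUnderTransfiniteComposition.{w} W]
    (F : J ⥤ K) [F.IsWellOrderContinuous] {i j : J} (hij : i ≤ j)
    (hF : ∀ k, i ≤ k → k < j → W (F.map (homOfLE (Order.le_succ k)))) :
    W (F.map (homOfLE hij)) := by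
  have hF' {a b : J} (hab : a ≤ b) (ha : i ≤ a) (haj : a < j) (hb : b = Order.succ a) :
      W (F.map (homOfLE hab)) := by
    subst hb
    exact hF a ha haj
  let G : Set.Ici i ⥤ K := (Subtype.mono_coe (· ∈ Set.Ici i)).functor ⋙ F
  have : G.IsWellOrderContinuous := Functor.IsWellOrderContinuous.restriction_setIci i
  let m : Set.Ici i := ⟨j, hij⟩
  refine W.transfiniteCompositionsOfShape_le (Set.Iic m) _
    ⟨{  F := (Set.initialSegIic m).monotone.functor ⋙ G
        isoBot := Iso.refl _
        incl := (coconeOfDiagramTerminal isTerminalTop _).ι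
        isColimit := colimitOfDiagramTerminal isTerminalTop _
        fac := Category.id_comp _
        map_mem k hk := hF' _ k.1.2 (Ne.lt_top (a := k) fun h => hk (h ▸ isMax_top)) ?_ }⟩
  exact (congrArg Subtype.val (Set.Iic.coe_succ_of_not_isMax hk)).trans
    (coe_succ_of_mem (k.1.2.trans (Order.le_succ _)))

end Sequences

/-! ## Iterating a successor structure along all ordinals -/

section Iteration

variable {K : Type u} [Category.{v} K]

instance essentiallySmall_Iio (o : Ordinal.{w}) : EssentiallySmall.{w} (Set.Iio o) :=
  essentiallySmall_of_small_of_locallySmall _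

/-- The sequence `Y` is obtained, up to isomorphism, by iterating the successor structure `Φ`
along all the ordinals of the universe, with colimits at limit ordinals. -/
structure IsIteration (Φ : SmallObject.SuccStruct K) (Y : Ordinal.{w} ⥤ K) : Prop where
  isWellOrderContinuous : Y.IsWellOrderContinuous
  zero : Nonempty (Y.obj 0 ≅ Φ.X₀)
  succ (β : Ordinal.{w}) : ∃ i : Y.obj (Order.succ β) ≅ Φ.succ (Y.obj β),
    Y.map (homOfLE (Order.le_succ β)) = Φ.toSucc (Y.obj β) ≫ i.inv

lemma IsIteration.map_mem {Φ : SmallObject.SuccStruct K} {Y : Ordinal.{w} ⥤ K}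
    (hY : IsIteration Φ Y) (W : MorphismProperty K) [W.RespectsIso]
    [MorphismProperty.IsStableUnderTransfiniteComposition.{w + 1} W]
    {β γ : Ordinal.{w}} (hβγ : β ≤ γ)
    (hW : ∀ δ, β ≤ δ → δ < γ → W (Φ.toSucc (Y.obj δ))) :
    W (Y.map (homOfLE hβγ)) := by
  have := hY.isWellOrderContinuous
  refine map_mem_of_map_succ_mem W Y hβγ fun δ hβδ hδγ => ?_
  obtain ⟨i, hi⟩ := hY.succ δ
  rw [hi]
  exact MorphismProperty.RespectsIso.postcomp W _ _ (hW δ hβδ hδγ)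

section Embedding

variable {L : Type u'} [Category.{v'} L] (J : K ⥤ L)
  (Φ : SmallObject.SuccStruct K)

/-- A chosen object of `K` which `J` sends to an object of its essential image, up to the
isomorphism `objPreimageIso`. -/
def objPreimage {P : L} (hP : J.essImage P) : K :=
  J.toEssImage.objPreimage ⟨P, hP⟩

/-- The isomorphism between an object of the essential image and the image of its preimage. -/
def objPreimageIso {P : L} (hP : J.essImage P) : J.obj (objPreimage J hP) ≅ P :=
  J.essImage.ι.mapIso (J.toEssImage.objObjPreimageIso ⟨P, hP⟩)

open Classical in
/-- The extension of a successor structure along a full embedding, by identities outside of its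
essential image. -/
def extendSuccStruct : SmallObject.SuccStruct L where
  X₀ := J.obj Φ.X₀
  succ P := if hP : J.essImage P then J.obj (Φ.succ (objPreimage J hP)) else P
  toSucc P := if hP : J.essImage P then
      (objPreimageIso J hP).inv ≫ J.map (Φ.toSucc (objPreimage J hP)) ≫
        eqToHom (by rw [dif_pos hP])
    else eqToHom (by rw [dif_neg hP])

/-- On the essential image, the extended successor structure agrees with the given one. -/
def extendSuccStructSuccIso {P : L} (hP : J.essImage P) :
    (extendSuccStruct J Φ).succ P ≅ J.obj (Φ.succ (objPreimage J hP)) :=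
  eqToIso (dif_pos hP)

lemma extendSuccStruct_toSucc {P : L} (hP : J.essImage P) :
    (extendSuccStruct J Φ).toSucc P = (objPreimageIso J hP).inv ≫
      J.map (Φ.toSucc (objPreimage J hP)) ≫ (extendSuccStructSuccIso J Φ hP).inv :=
  dif_pos hP

variable [J.Full] [J.Faithful] [HasIterationOfShape Ordinal.{w} L]
  [∀ o : Ordinal.{w}, HasColimitsOfShape (Set.Iio o) K]
  [∀ o : Ordinal.{w}, PreservesColimitsOfShape (Set.Iio o) J]

lemma essImage_iterationFunctor_obj (β : Ordinal.{w}) :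
    J.essImage (((extendSuccStruct J Φ).iterationFunctor Ordinal.{w}).obj β) := by
  induction β using SuccOrder.limitRecOn with
  | isMin β hβ =>
    obtain rfl := hβ.eq_bot
    exact ⟨_, ⟨((extendSuccStruct J Φ).iterationFunctorObjBotIso _).symm⟩⟩
  | succ β hβ h =>
    exact ⟨_, ⟨(extendSuccStructSuccIso J Φ h).symm ≪≫
      ((extendSuccStruct J Φ).iterationFunctorObjSuccIso β hβ).symm⟩⟩
  | isSuccLimit β hβ h =>
    let F := (extendSuccStruct J Φ).iterationFunctor Ordinal.{w}
    let e := Functor.essImage.liftFunctorCompIso ((Set.principalSegIio β).monotone.functor ⋙ F) J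
      (fun γ => h γ.1 γ.2)
    exact ⟨_, ⟨(isColimitOfPreserves J (colimit.isColimit _)).coconePointsIsoOfNatIso
      (F.isColimitOfIsWellOrderContinuous β hβ) e⟩⟩

include J in
lemma exists_isIteration_of_embedding : ∃ Y : Ordinal.{w} ⥤ K, IsIteration Φ Y := by
  let Ψ := extendSuccStruct J Φ
  let F := Ψ.iterationFunctor Ordinal.{w}
  have hF : ∀ β, J.essImage (F.obj β) := essImage_iterationFunctor_obj J Φ
  let Y := Functor.essImage.liftFunctor F J hF
  let e : Y ⋙ J ≅ F := Functor.essImage.liftFunctorCompIso F J hF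
  refine ⟨Y, ⟨⟨fun l hl => ?_⟩, ?_, fun β => ?_⟩⟩
  · have := Functor.isWellOrderContinuous_of_iso e.symm
    exact ⟨isColimitOfReflects J ((Y ⋙ J).isColimitOfIsWellOrderContinuous l hl)⟩
  · exact ⟨J.preimageIso (e.app 0 ≪≫ Ψ.iterationFunctorObjBotIso _)⟩
  · let i : F.obj (Order.succ β) ≅ J.obj (Φ.succ (Y.obj β)) :=
      Ψ.iterationFunctorObjSuccIso β (not_isMax β) ≪≫ extendSuccStructSuccIso J Φ (hF β)
    refine ⟨J.preimageIso (e.app (Order.succ β) ≪≫ i), J.map_injective ?_⟩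
    have hΨ : F.map (homOfLE (Order.le_succ β)) =
        e.inv.app β ≫ J.map (Φ.toSucc (Y.obj β)) ≫ i.inv := by
      rw [Ψ.iterationFunctor_map_succ β (not_isMax β), extendSuccStruct_toSucc J Φ (hF β),
        Category.assoc, Category.assoc]
      rfl
    calc J.map (Y.map (homOfLE (Order.le_succ β)))
        = e.hom.app β ≫ F.map (homOfLE (Order.le_succ β)) ≫ e.inv.app (Order.succ β) :=
          (NatIso.naturality_1 e.symm (homOfLE (Order.le_succ β))).symm
      _ = J.map (Φ.toSucc (Y.obj β) ≫ (J.preimageIso (e.app (Order.succ β) ≪≫ i)).inv) := by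
          rw [hΨ, J.map_comp, Functor.preimageIso_inv, J.map_preimage]
          simp

end Embedding

/-- The colimits of `K` need only be small, while the iteration runs through a large well-ordered
type: it is carried out in the bicomplete category into which `K` embeds by the dual Yoneda
embedding, and stays in the essential image of `K`. -/
theorem exists_isIteration [HasColimitsOfSize.{w, w} K] (Φ : SmallObject.SuccStruct K) :
    ∃ Y : Ordinal.{w} ⥤ K, IsIteration Φ Y := by
  have (o : Ordinal.{w}) : HasColimitsOfShape (Set.Iio o) K :=
    hasColimitsOfShape_of_essentiallySmall.{w} _ _
  let J : K ⥤ (Kᵒᵖᵒᵖ ⥤ Type (max (w + 1) v))ᵒᵖ := (uliftYoneda.{w + 1} (C := Kᵒᵖ)).rightOp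
  have : HasColimitsOfSize.{w + 1, w + 1} (Kᵒᵖᵒᵖ ⥤ Type (max (w + 1) v))ᵒᵖ := by
    have : HasLimitsOfSize.{w + 1, w + 1} (Kᵒᵖᵒᵖ ⥤ Type (max (w + 1) v)) := inferInstance
    infer_instance
  have (o : Ordinal.{w}) : PreservesColimitsOfShape (Set.Iio o) J := by
    have := preservesColimitsOfSize_rightOp.{w + 1, w + 1} (uliftYoneda.{w + 1} (C := Kᵒᵖ))
    infer_instance
  exact exists_isIteration_of_embedding J Φ

end Iteration

/-! ## Kelly's transfinite sequence -/

section KellySequence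

variable {D : Type u} [Category.{v} D] {T : D ⥤ D}

variable (T) in
/-- A stage of Kelly's construction is a map `T A ⟶ B`; in the transfinite sequence the stages are
the maps `x β : T (X β) ⟶ X (β + 1)`. -/
abbrev Stage := Comma T (𝟭 D)

section StageColimits

variable {J : Type u'} [Category.{v'} J] [HasColimitsOfShape J D] (F : J ⥤ Stage T)

/-- The comparison `colim T (A j) ⟶ T (colim A j)` for a diagram of stages `T (A j) ⟶ B j`. -/
def stageColimitComparison :
    colimit (F ⋙ Comma.fst T (𝟭 D) ⋙ T) ⟶ T.obj (colimit (F ⋙ Comma.fst T (𝟭 D))) :=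
  colimit.post (F ⋙ Comma.fst T (𝟭 D)) T

/-- The map `colim T (A j) ⟶ colim B j` induced by a diagram of stages `T (A j) ⟶ B j`. -/
def stageColimitMap :
    colimit (F ⋙ Comma.fst T (𝟭 D) ⋙ T) ⟶ colimit (F ⋙ Comma.snd T (𝟭 D)) :=
  colim.map (Functor.whiskerLeft F (Comma.natTrans T (𝟭 D)))

lemma ι_stageColimitComparison (j : J) :
    colimit.ι (F ⋙ Comma.fst T (𝟭 D) ⋙ T) j ≫ stageColimitComparison F =
      T.map (colimit.ι (F ⋙ Comma.fst T (𝟭 D)) j) :=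
  colimit.ι_post (F ⋙ Comma.fst T (𝟭 D)) T j

lemma ι_stageColimitMap (j : J) :
    colimit.ι (F ⋙ Comma.fst T (𝟭 D) ⋙ T) j ≫ stageColimitMap F =
      (F.obj j).hom ≫ colimit.ι (F ⋙ Comma.snd T (𝟭 D)) j :=
  ι_colimMap _ _

variable [HasPushouts D]

/-- The colimit cocone of a diagram of stages `T (A j) ⟶ B j`: since `T` need not preserve the
colimit `A` of the `A j`, its target is the pushout of `T A` and `colim B j` under
`colim T (A j)`. -/
def stageCocone : Cocone F where
  pt :=
    { left := colimit (F ⋙ Comma.fst T (𝟭 D))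
      right := pushout (stageColimitComparison F) (stageColimitMap F)
      hom := pushout.inl _ _ }
  ι :=
    { app j :=
        { left := colimit.ι (F ⋙ Comma.fst T (𝟭 D)) j
          right := colimit.ι (F ⋙ Comma.snd T (𝟭 D)) j ≫ pushout.inr _ _
          w := by
            have h := congrArg (colimit.ι (F ⋙ Comma.fst T (𝟭 D) ⋙ T) j ≫ ·)
              (pushout.condition (f := stageColimitComparison F) (g := stageColimitMap F))
            simp only [reassoc_of% (ι_stageColimitComparison F),
              reassoc_of% (ι_stageColimitMap F)] at h
            exact h }
      naturality i j f := by
        ext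
        · simpa using colimit.w (F ⋙ Comma.fst T (𝟭 D)) f
        · simpa using congrArg (· ≫ pushout.inr (stageColimitComparison F) (stageColimitMap F))
            (colimit.w (F ⋙ Comma.snd T (𝟭 D)) f) }

/-- The universal property of `stageCocone`. -/
def isColimitStageCocone : IsColimit (stageCocone F) where
  desc s :=
    { left := colimit.desc _ ((Comma.fst T (𝟭 D)).mapCocone s)
      right := pushout.desc
        (T.map (colimit.desc _ ((Comma.fst T (𝟭 D)).mapCocone s)) ≫ s.pt.hom)
        (colimit.desc _ ((Comma.snd T (𝟭 D)).mapCocone s)) (by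
          refine colimit.hom_ext fun j => ?_
          rw [reassoc_of% (ι_stageColimitComparison F), reassoc_of% (ι_stageColimitMap F),
            ← T.map_comp_assoc, colimit.ι_desc, colimit.ι_desc]
          exact (s.ι.app j).w)
      w := (pushout.inl_desc _ _ _).symm }
  fac s j := by
    ext
    · exact colimit.ι_desc _ _
    · dsimp [stageCocone]
      rw [Category.assoc, pushout.inr_desc]
      exact colimit.ι_desc _ _
  uniq s m hm := by
    have hleft : m.left = colimit.desc _ ((Comma.fst T (𝟭 D)).mapCocone s) :=
      colimit.hom_ext fun j => (congrArg CommaMorphism.left (hm j)).trans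
        (colimit.ι_desc ((Comma.fst T (𝟭 D)).mapCocone s) j).symm
    ext
    · exact hleft
    · apply pushout.hom_ext
      · rw [pushout.inl_desc, ← hleft]
        exact m.w.symm
      · rw [pushout.inr_desc]
        refine colimit.hom_ext fun j => ?_
        rw [colimit.ι_desc]
        exact (Category.assoc _ _ _).symm.trans (congrArg CommaMorphism.right (hm j))

instance hasColimitsOfShape_stage : HasColimitsOfShape J (Stage T) where
  has_colimit F := ⟨⟨⟨_, isColimitStageCocone F⟩⟩⟩

instance preservesColimitsOfShape_fst_stage :
    PreservesColimitsOfShape J (Comma.fst T (𝟭 D)) where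
  preservesColimit {F} := preservesColimit_of_preserves_colimit_cocone (isColimitStageCocone F)
    (colimit.isColimit (F ⋙ Comma.fst T (𝟭 D)))

end StageColimits

variable (τ : 𝟭 D ⟶ T)

/-- The map `A ⟶ B` underlying a stage `T A ⟶ B`. -/
def stageMap (V : Stage T) : V.left ⟶ V.right := τ.app V.left ≫ V.hom

lemma stageMap_naturality {V W : Stage T} (φ : V ⟶ W) :
    φ.left ≫ stageMap τ W = stageMap τ V ≫ φ.right := by
  have hτ : φ.left ≫ τ.app W.left = τ.app V.left ≫ T.map φ.left := τ.naturality φ.left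
  have hφ : T.map φ.left ≫ W.hom = V.hom ≫ φ.right := φ.w
  rw [stageMap, stageMap, reassoc_of% hτ, hφ, Category.assoc]

variable [HasCoequalizers D]

/-- The stage following `a : T A ⟶ B`: the coequalizer `T B ⟶ B'` of the two maps `T A ⟶ T B`
given by `a` followed by the point, and by `T` of the underlying map `A ⟶ B`. -/
def stageSucc (V : Stage T) : Stage T where
  left := V.right
  right := coequalizer (V.hom ≫ τ.app V.right) (T.map (stageMap τ V))
  hom := coequalizer.π (V.hom ≫ τ.app V.right) (T.map (stageMap τ V))

/-- The structure map `T B ⟶ B'` of `stageSucc`, with the source spelled out. -/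
def stageProj (V : Stage T) : T.obj V.right ⟶ (stageSucc τ V).right :=
  coequalizer.π (V.hom ≫ τ.app V.right) (T.map (stageMap τ V))

lemma stageProj_condition (V : Stage T) :
    V.hom ≫ τ.app V.right ≫ stageProj τ V = T.map (stageMap τ V) ≫ stageProj τ V := by
  rw [← Category.assoc]
  exact coequalizer.condition _ _

instance epi_stageProj (V : Stage T) : Epi (stageProj τ V) :=
  inferInstanceAs (Epi (coequalizer.π (V.hom ≫ τ.app V.right) (T.map (stageMap τ V))))

lemma exists_stageProj_comp_eq {V : Stage T} {Z : D} (h : T.obj V.right ⟶ Z)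
    (w : V.hom ≫ τ.app V.right ≫ h = T.map (stageMap τ V) ≫ h) :
    ∃ k : (stageSucc τ V).right ⟶ Z, stageProj τ V ≫ k = h :=
  ⟨coequalizer.desc h (by rwa [Category.assoc]), coequalizer.π_desc _ _⟩

/-- The map from a stage to the following one. -/
def toStageSucc (V : Stage T) : V ⟶ stageSucc τ V where
  left := stageMap τ V
  right := stageMap τ (stageSucc τ V)
  w := (stageProj_condition τ V).symm

/-- The successor structure on stages which starts with `𝟙 : T A ⟶ T A`. -/
def stageSuccStruct (A : D) : SmallObject.SuccStruct (Stage T) where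
  X₀ := { left := A, right := T.obj A, hom := 𝟙 _ }
  succ := stageSucc τ
  toSucc := toStageSucc τ

variable {τ} {A : D} {Y : Ordinal.{v} ⥤ Stage T} (hY : IsIteration (stageSuccStruct τ A) Y)

/-- The identification of a successor stage of an iteration with the stage following its
predecessor. -/
def stageIso (β : Ordinal.{v}) : Y.obj (Order.succ β) ≅ stageSucc τ (Y.obj β) :=
  (hY.succ β).choose

lemma map_le_succ_eq (β : Ordinal.{v}) :
    Y.map (homOfLE (Order.le_succ β)) = toStageSucc τ (Y.obj β) ≫ (stageIso hY β).inv :=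
  (hY.succ β).choose_spec

/-- The identification of the target of a stage with the source of the following one. -/
def stageShift (β : Ordinal.{v}) : (Y.obj β).right ≅ (Y.obj (Order.succ β)).left :=
  ((Comma.fst T (𝟭 D)).mapIso (stageIso hY β)).symm

/-- The identification of the target of a successor stage with a coequalizer. -/
def stageTargetIso (β : Ordinal.{v}) :
    (stageSucc τ (Y.obj β)).right ≅ (Y.obj (Order.succ β)).right :=
  ((Comma.snd T (𝟭 D)).mapIso (stageIso hY β)).symm

lemma map_stageShift_hom (β : Ordinal.{v}) :
    T.map (stageShift hY β).hom ≫ (Y.obj (Order.succ β)).hom =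
      stageProj τ (Y.obj β) ≫ (stageTargetIso hY β).hom :=
  (stageIso hY β).inv.w

lemma map_le_succ_left (β : Ordinal.{v}) :
    (Y.map (homOfLE (Order.le_succ β))).left =
      stageMap τ (Y.obj β) ≫ (stageShift hY β).hom :=
  congrArg CommaMorphism.left (map_le_succ_eq hY β)

lemma map_le_succ_right (β : Ordinal.{v}) :
    (Y.map (homOfLE (Order.le_succ β))).right =
      (stageShift hY β).hom ≫ stageMap τ (Y.obj (Order.succ β)) :=
  (congrArg CommaMorphism.right (map_le_succ_eq hY β)).trans
    (stageMap_naturality τ (stageIso hY β).inv).symm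

lemma map_right_eq_of_succ_le {β γ : Ordinal.{v}} (h : Order.succ β ≤ γ) :
    (Y.map (homOfLE ((Order.le_succ β).trans h))).right =
      (stageShift hY β).hom ≫ (Y.map (homOfLE h)).left ≫ stageMap τ (Y.obj γ) := by
  rw [← homOfLE_comp (Order.le_succ β) h, Y.map_comp, Comma.comp_right, map_le_succ_right hY,
    Category.assoc, stageMap_naturality]

lemma map_right_stageShift_hom {β γ : Ordinal.{v}} (h : β ≤ γ) :
    (Y.map (homOfLE h)).right ≫ (stageShift hY γ).hom =
      (stageShift hY β).hom ≫ (Y.map (homOfLE (Order.succ_le_succ h))).left := by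
  obtain rfl | hlt := h.eq_or_lt
  · simp
  · have hs : Order.succ β ≤ γ := Order.succ_le_of_lt hlt
    rw [map_right_eq_of_succ_le hY hs, ← homOfLE_comp hs (Order.le_succ γ), Y.map_comp,
      Comma.comp_left, map_le_succ_left hY, Category.assoc, Category.assoc]

include hY in
lemma isIso_stage_zero : IsIso (Y.obj 0).hom := by
  let e : Y.obj 0 ≅ { left := A, right := T.obj A, hom := 𝟙 _ } := hY.zero.some
  have he : T.map e.hom.left ≫ 𝟙 (T.obj A) = (Y.obj 0).hom ≫ e.hom.right := e.hom.w
  have : IsIso ((Y.obj 0).hom ≫ e.hom.right) := by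
    rw [← he]
    infer_instance
  exact IsIso.of_isIso_comp_right _ e.hom.right

lemma stage_condition_succ (β : Ordinal.{v}) :
    (Y.obj β).hom ≫ (stageShift hY β).hom ≫ τ.app (Y.obj (Order.succ β)).left ≫
        (Y.obj (Order.succ β)).hom =
      T.map (Y.map (homOfLE (Order.le_succ β))).left ≫ (Y.obj (Order.succ β)).hom := by
  have hτ : (stageShift hY β).hom ≫ τ.app (Y.obj (Order.succ β)).left =
      τ.app (Y.obj β).right ≫ T.map (stageShift hY β).hom := τ.naturality (stageShift hY β).hom
  rw [map_le_succ_left hY, T.map_comp, Category.assoc, reassoc_of% hτ, map_stageShift_hom,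
    reassoc_of% (stageProj_condition τ (Y.obj β))]

lemma existsUnique_stage_succ (β : Ordinal.{v}) {Z : D}
    (h : T.obj (Y.obj (Order.succ β)).left ⟶ Z)
    (w : (Y.obj β).hom ≫ (stageShift hY β).hom ≫ τ.app (Y.obj (Order.succ β)).left ≫ h =
      T.map (Y.map (homOfLE (Order.le_succ β))).left ≫ h) :
    ∃! k : (Y.obj (Order.succ β)).right ⟶ Z, (Y.obj (Order.succ β)).hom ≫ k = h := by
  have hτ : (stageShift hY β).hom ≫ τ.app (Y.obj (Order.succ β)).left =
      τ.app (Y.obj β).right ≫ T.map (stageShift hY β).hom := τ.naturality (stageShift hY β).hom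
  obtain ⟨k, hk⟩ := exists_stageProj_comp_eq τ (T.map (stageShift hY β).hom ≫ h) (by
    rwa [← T.map_comp_assoc, ← map_le_succ_left hY, ← reassoc_of% hτ])
  have hcomp (m : (Y.obj (Order.succ β)).right ⟶ Z) :
      (Y.obj (Order.succ β)).hom ≫ m = h ↔ (stageTargetIso hY β).hom ≫ m = k := by
    rw [← cancel_epi (T.map (stageShift hY β).hom), reassoc_of% (map_stageShift_hom hY β), ← hk,
      cancel_epi]
  simpa only [hcomp, ← Iso.eq_inv_comp] using existsUnique_eq

lemma stage_condition_limit {l β : Ordinal.{v}} (h : Order.succ β ≤ l) :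
    T.map (Y.map (homOfLE ((Order.le_succ β).trans h))).left ≫ (Y.obj l).hom =
      (Y.obj β).hom ≫ (stageShift hY β).hom ≫ (Y.map (homOfLE h)).left ≫
        τ.app (Y.obj l).left ≫ (Y.obj l).hom := by
  have hw : T.map (Y.map (homOfLE ((Order.le_succ β).trans h))).left ≫ (Y.obj l).hom =
      (Y.obj β).hom ≫ (Y.map (homOfLE ((Order.le_succ β).trans h))).right :=
    (Y.map (homOfLE ((Order.le_succ β).trans h))).w
  rw [hw, map_right_eq_of_succ_le hY h, stageMap]

section

variable [HasColimits D]

include hY in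
lemma isWellOrderContinuous_comp_fst : (Y ⋙ Comma.fst T (𝟭 D)).IsWellOrderContinuous := by
  have := hY.isWellOrderContinuous
  refine ⟨fun l hl => ?_⟩
  have : HasColimitsOfShape (Set.Iio l) D := hasColimitsOfShape_of_essentiallySmall.{v} _ _
  exact ⟨isColimitOfPreserves (Comma.fst T (𝟭 D)) (Y.isColimitOfIsWellOrderContinuous l hl)⟩

lemma existsUnique_stage_limit {l : Ordinal.{v}} (hl : Order.IsSuccLimit l) {Z : D}
    (h : T.obj (Y.obj l).left ⟶ Z)
    (w : ∀ (β : Ordinal.{v}) (hβ : β < l), T.map (Y.map (homOfLE hβ.le)).left ≫ h =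
      (Y.obj β).hom ≫ (stageShift hY β).hom ≫
        (Y.map (homOfLE (Order.succ_le_of_lt hβ))).left ≫ τ.app (Y.obj l).left ≫ h) :
    ∃! k : (Y.obj l).right ⟶ Z, (Y.obj l).hom ≫ k = h := by
  have := hY.isWellOrderContinuous
  have := isWellOrderContinuous_comp_fst hY
  let W : Stage T := { left := (Y.obj l).left, right := Z, hom := h }
  let φ (β : Ordinal.{v}) (hβ : β < l) : Y.obj β ⟶ W :=
    { left := (Y.map (homOfLE hβ.le)).left
      right := (stageShift hY β).hom ≫ (Y.map (homOfLE (Order.succ_le_of_lt hβ))).left ≫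
        τ.app (Y.obj l).left ≫ h
      w := w β hβ }
  have hφ (β γ : Ordinal.{v}) (hβγ : β ≤ γ) (hγ : γ < l) :
      Y.map (homOfLE hβγ) ≫ φ γ hγ = φ β (hβγ.trans_lt hγ) := by
    ext
    · exact ((Y ⋙ Comma.fst T (𝟭 D)).map_comp (homOfLE hβγ) (homOfLE hγ.le)).symm
    · dsimp only [φ, Comma.comp_right]
      rw [← Category.assoc, map_right_stageShift_hom hY, Category.assoc,
        ← homOfLE_comp (Order.succ_le_succ hβγ) (Order.succ_le_of_lt hγ), Y.map_comp,
        Comma.comp_left, Category.assoc]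
  obtain ⟨Φ, hΦ, hΦ'⟩ := existsUnique_desc_of_isSuccLimit Y hl φ hφ
  have hleft : Φ.left = 𝟙 (Y.obj l).left :=
    hom_ext_of_isSuccLimit (Y ⋙ Comma.fst T (𝟭 D)) hl fun β hβ =>
      (congrArg CommaMorphism.left (hΦ β hβ)).trans (Category.comp_id _).symm
  refine ⟨Φ.right, ?_, fun k hk => ?_⟩
  · calc (Y.obj l).hom ≫ Φ.right = T.map Φ.left ≫ h := Φ.w.symm
      _ = h := by rw [hleft]; exact (congrArg (· ≫ h) (T.map_id _)).trans (Category.id_comp h)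
  · let Ψ : Y.obj l ⟶ W := { left := 𝟙 _, right := k, w := by simpa [W] using hk.symm }
    refine congrArg CommaMorphism.right (hΦ' Ψ fun β hβ => ?_)
    ext
    · exact Category.comp_id _
    · dsimp only [Ψ, φ, Comma.comp_right]
      rw [map_right_eq_of_succ_le hY (Order.succ_le_of_lt hβ), stageMap, ← hk]
      simp only [Category.assoc]

/-- Kelly's sequence consists of the sources of the stages obtained by iteration. -/
def freeAlgebraSequence : FreeAlgebraSequence T τ A where
  X := Y ⋙ Comma.fst T (𝟭 D)
  x β := (Y.obj β).hom ≫ (stageShift hY β).hom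
  zero := (Comma.fst T (𝟭 D)).mapIso hY.zero.some.symm
  unit_x β := by
    rw [← Category.assoc]
    exact (map_le_succ_left hY β).symm
  isIso_x_zero := by
    have := isIso_stage_zero hY
    infer_instance
  condition_succ β := by
    simp only [Category.assoc]
    exact (reassoc_of% (stage_condition_succ hY β)) (stageShift hY _).hom
  isColimit_succ β := by
    refine ⟨Cofork.IsColimit.mk' _ fun s => ?_⟩
    have hs := s.condition
    simp only [Category.assoc] at hs
    have hk := existsUnique_stage_succ hY β s.π hs
    exact ⟨(stageShift hY _).inv ≫ hk.choose, by simpa using hk.choose_spec.1,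
      fun hm => (Iso.eq_inv_comp _).2 (hk.choose_spec.2 _ (by simpa using hm))⟩
  isWellOrderContinuous := isWellOrderContinuous_comp_fst hY
  condition_limit l _ β hβ := by
    simp only [Category.assoc]
    exact (reassoc_of% (stage_condition_limit hY (Order.succ_le_of_lt hβ)))
      (stageShift hY l).hom
  existsUnique_limit l hl Z h w := by
    simp only [Category.assoc] at w
    obtain ⟨k, hk, hk'⟩ := existsUnique_stage_limit hY hl h w
    exact ⟨(stageShift hY l).inv ≫ k, by simpa using hk,
      fun m hm => (Iso.eq_inv_comp _).2 (hk' _ (by simpa using hm))⟩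

end

end KellySequence

/-! ## The free monad of a left adjoint -/

section FreeMonadOfAdjunction

variable {D : Type u} [Category.{v} D] {T : D ⥤ D} {τ : 𝟭 D ⟶ T}

lemma PointedAlgebra.hom_heq {A A' B B' : PointedAlgebra T τ} (hA : A = A') (hB : B = B')
    {g : A ⟶ B} {h : A' ⟶ B'} (w : g.f ≍ h.f) : g ≍ h := by
  subst hA hB
  exact heq_of_eq (PointedAlgebra.Hom.ext (eq_of_heq w))

lemma algebra_hom_heq {M : Monad D} {A A' B B' : M.Algebra} (hA : A = A') (hB : B = B')
    {g : A ⟶ B} {h : A' ⟶ B'} (w : g.f ≍ h.f) : g ≍ h := by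
  subst hA hB
  exact heq_of_eq (Monad.Algebra.Hom.ext' _ _ _ _ (eq_of_heq w))

variable {L : D ⥤ PointedAlgebra T τ} (adj : L ⊣ PointedAlgebra.forget T τ)

/-- The unit of an adjunction with the forgetful functor, with its target spelled out. -/
def freeUnit (A : D) : A ⟶ (L.obj A).carrier := adj.unit.app A

/-- The counit of an adjunction with the forgetful functor, with its source spelled out. -/
def freeCounit (A : PointedAlgebra T τ) : L.obj A.carrier ⟶ A := adj.counit.app A

/-- The structure map of an algebra of the monad of the adjunction, with its source spelled
out. -/
def monadStr (Q : adj.toMonad.Algebra) : (L.obj Q.A).carrier ⟶ Q.A := Q.a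

lemma freeUnit_naturality {A B : D} (g : A ⟶ B) :
    g ≫ freeUnit adj B = freeUnit adj A ≫ (L.map g).f :=
  adj.unit.naturality g

lemma freeUnit_freeCounit (A : PointedAlgebra T τ) :
    freeUnit adj A.carrier ≫ (freeCounit adj A).f = 𝟙 A.carrier :=
  adj.right_triangle_components A

lemma free_hom_ext {A : D} {B : PointedAlgebra T τ} {g h : L.obj A ⟶ B}
    (w : freeUnit adj A ≫ g.f = freeUnit adj A ≫ h.f) : g = h :=
  (adj.homEquiv A B).injective w

lemma map_freeUnit_str_freeCounit (A : PointedAlgebra T τ) :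
    T.map (freeUnit adj A.carrier) ≫ (L.obj A.carrier).str ≫ (freeCounit adj A).f = A.str := by
  rw [← (freeCounit adj A).comm, ← T.map_comp_assoc]
  exact (congrArg (fun k => T.map k ≫ A.str) (freeUnit_freeCounit adj A)).trans (by simp)

lemma freeUnit_monadStr (Q : adj.toMonad.Algebra) : freeUnit adj Q.A ≫ monadStr adj Q = 𝟙 Q.A :=
  Q.unit

lemma monadStr_naturality {Q Q' : adj.toMonad.Algebra} (h : Q ⟶ Q') :
    (L.map h.f).f ≫ monadStr adj Q' = monadStr adj Q ≫ h.f :=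
  h.h

lemma map_monadStr_monadStr (Q : adj.toMonad.Algebra) :
    (L.map (monadStr adj Q)).f ≫ monadStr adj Q =
      (freeCounit adj (L.obj Q.A)).f ≫ monadStr adj Q :=
  Q.assoc.symm

/-- The pointed algebra underlying an algebra of the monad of the adjunction: `T` acts through the
free algebra. -/
def pointedOfMonad (Q : adj.toMonad.Algebra) : PointedAlgebra T τ where
  carrier := Q.A
  str := T.map (freeUnit adj Q.A) ≫ (L.obj Q.A).str ≫ monadStr adj Q
  unit := by
    have hτ : freeUnit adj Q.A ≫ τ.app (L.obj Q.A).carrier =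
        τ.app Q.A ≫ T.map (freeUnit adj Q.A) := τ.naturality (freeUnit adj Q.A)
    rw [← reassoc_of% hτ, reassoc_of% (L.obj Q.A).unit, freeUnit_monadStr]

/-- The functor from algebras of the monad to pointed algebras. -/
def monadToPointed : adj.toMonad.Algebra ⥤ PointedAlgebra T τ where
  obj := pointedOfMonad adj
  map {Q Q'} h :=
    { f := h.f
      comm := by
        dsimp only [pointedOfMonad]
        rw [← T.map_comp_assoc, freeUnit_naturality, T.map_comp_assoc,
          reassoc_of% (L.map h.f).comm, monadStr_naturality]
        simp only [Category.assoc] }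
  map_id _ := rfl
  map_comp _ _ := rfl

/-- The structure map of an algebra of the monad, as a map of pointed algebras. -/
def monadStrHom (Q : adj.toMonad.Algebra) : L.obj Q.A ⟶ pointedOfMonad adj Q where
  f := monadStr adj Q
  comm := by
    have h := congrArg (· ≫ monadStr adj Q) (map_freeUnit_str_freeCounit adj (L.obj Q.A))
    simp only [Category.assoc] at h
    dsimp only [pointedOfMonad]
    rw [← T.map_comp_assoc, freeUnit_naturality, T.map_comp_assoc,
      reassoc_of% (L.map (monadStr adj Q)).comm, map_monadStr_monadStr]
    exact h

lemma freeCounit_pointedOfMonad (Q : adj.toMonad.Algebra) :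
    freeCounit adj (pointedOfMonad adj Q) = monadStrHom adj Q :=
  free_hom_ext adj ((freeUnit_freeCounit adj _).trans (freeUnit_monadStr adj Q).symm)

/-- The monad of any adjunction with the forgetful functor is algebraically free. -/
def FreeMonad.ofAdjunction : FreeMonad T τ where
  monad := adj.toMonad
  toPointed := monadToPointed adj
  ofPointed := Monad.comparison adj
  toPointed_ofPointed := by
    have hobj (Q : adj.toMonad.Algebra) :
        (monadToPointed adj ⋙ Monad.comparison adj).obj Q = Q := by
      have h := congrArg PointedAlgebra.Hom.f (freeCounit_pointedOfMonad adj Q)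
      obtain ⟨A, a, _, _⟩ := Q
      change Monad.Algebra.mk _ _ _ _ = Monad.Algebra.mk _ _ _ _
      congr
    exact CategoryTheory.Functor.hext hobj fun Q Q' h =>
      algebra_hom_heq (hobj Q) (hobj Q') HEq.rfl
  ofPointed_toPointed := by
    have hobj (A : PointedAlgebra T τ) :
        (Monad.comparison adj ⋙ monadToPointed adj).obj A = A := by
      have h := map_freeUnit_str_freeCounit adj A
      obtain ⟨A, a, _⟩ := A
      change PointedAlgebra.mk _ _ _ = PointedAlgebra.mk _ _ _
      congr
    exact CategoryTheory.Functor.hext hobj fun A A' h =>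
      PointedAlgebra.hom_heq (hobj A) (hobj A') HEq.rfl
  toPointed_forget := rfl

theorem freeMonadExistsConstructively_of_free
    (h : ∀ A : D, ∃ (S : FreeAlgebraSequence T τ A) (β : Ordinal.{v}) (B : PointedAlgebra T τ)
      (e : S.X.obj β ≅ B.carrier), S.ConvergesAt β ∧
      S.x β = T.map e.hom ≫ B.str ≫ e.inv ≫ S.X.map (homOfLE (Order.le_succ β)) ∧
      ∀ B' : PointedAlgebra T τ, Function.Bijective fun k : B ⟶ B' =>
        (S.zero.hom ≫ S.X.map (homOfLE (zero_le : 0 ≤ β)) ≫ e.hom) ≫ k.f) :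
    FreeMonadExistsConstructively T τ := by
  choose S β B e hconv hstr huniv using h
  let η (A : D) : A ⟶ (B A).carrier :=
    (S A).zero.hom ≫ (S A).X.map (homOfLE (zero_le : 0 ≤ β A)) ≫ (e A).hom
  let homEquiv (A : D) (B' : PointedAlgebra T τ) :
      (B A ⟶ B') ≃ (A ⟶ (PointedAlgebra.forget T τ).obj B') :=
    Equiv.ofBijective (fun k => η A ≫ k.f) (huniv A B')
  let adj := Adjunction.adjunctionOfEquivLeft homEquiv fun A B' B'' l k =>
    (Category.assoc (η A) k.f l.f).symm
  have hη (A : D) : freeUnit adj A = η A := by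
    change homEquiv A (B A) (𝟙 _) = η A
    exact Category.comp_id (η A)
  refine ⟨FreeMonad.ofAdjunction adj, fun A => ⟨S A, β A, hconv A, e A, ?_, ?_⟩⟩
  · change η A = freeUnit adj A ≫ 𝟙 _
    rw [hη, Category.comp_id]
  · have hB : ((FreeMonad.ofAdjunction adj).toPointed.obj
        ((FreeMonad.ofAdjunction adj).monad.free.obj A)).str = (B A).str :=
      map_freeUnit_str_freeCounit adj (B A)
    rw [hB]
    exact hstr A

end FreeMonadOfAdjunction

/-! ## Convergence of Kelly's sequence to free algebras -/

section Stage

variable {D : Type u} [Category.{v} D] {T : D ⥤ D} {τ : 𝟭 D ⟶ T}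

/-- The stage `T B ⟶ B` of a pointed algebra. -/
abbrev PointedAlgebra.stage (B : PointedAlgebra T τ) : Stage T where
  left := B.carrier
  right := B.carrier
  hom := B.str

lemma stageMap_stage (B : PointedAlgebra T τ) : stageMap τ B.stage = 𝟙 B.carrier := B.unit

lemma stageMap_comp_right {V : Stage T} {B : PointedAlgebra T τ} (φ : V ⟶ B.stage) :
    stageMap τ V ≫ φ.right = φ.left := by
  rw [← stageMap_naturality, stageMap_stage]
  exact Category.comp_id _

lemma stage_hom_ext {V : Stage T} {B : PointedAlgebra T τ} {φ ψ : V ⟶ B.stage}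
    (w : φ.right = ψ.right) : φ = ψ := by
  ext
  · rw [← stageMap_comp_right φ, ← stageMap_comp_right ψ, w]
  · exact w

lemma bijective_left_of_isIso_hom {V : Stage T} [IsIso V.hom] (W : Stage T) :
    Function.Bijective fun φ : V ⟶ W => φ.left := by
  refine ⟨fun φ ψ (h : φ.left = ψ.left) => ?_, fun g => ?_⟩
  · ext
    · exact h
    · have hφ : V.hom ≫ φ.right = T.map φ.left ≫ W.hom := φ.w.symm
      have hψ : V.hom ≫ ψ.right = T.map ψ.left ≫ W.hom := ψ.w.symm
      rw [← cancel_epi V.hom, hφ, hψ, h]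
  · exact ⟨{ left := g, right := inv V.hom ≫ T.map g ≫ W.hom, w := by simp }, rfl⟩

lemma isIso_stageMap_of_iso {V W : Stage T} (e : V ≅ W) [IsIso (stageMap τ V)] :
    IsIso (stageMap τ W) := by
  have hid : e.inv.left ≫ e.hom.left = 𝟙 W.left := congrArg CommaMorphism.left e.inv_hom_id
  have h : e.inv.left ≫ stageMap τ V ≫ e.hom.right = stageMap τ W := by
    rw [← stageMap_naturality, reassoc_of% hid]
  rw [← h]
  infer_instance

/-- The pointed algebra given by a stage `a : T A ⟶ B` for which `A ⟶ B` is invertible. -/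
abbrev algebraOfStage (V : Stage T) [IsIso (stageMap τ V)] : PointedAlgebra T τ where
  carrier := V.left
  str := V.hom ≫ inv (stageMap τ V)
  unit := by
    rw [← Category.assoc]
    exact IsIso.hom_inv_id (stageMap τ V)

/-- A stage `a : T A ⟶ B` for which `A ⟶ B` is invertible corepresents the same functor as its
pointed algebra. -/
def algebraOfStageHomEquiv (V : Stage T) [IsIso (stageMap τ V)] (B : PointedAlgebra T τ) :
    (algebraOfStage (τ := τ) V ⟶ B) ≃ (V ⟶ B.stage) where
  toFun k :=
    { left := k.f
      right := inv (stageMap τ V) ≫ k.f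
      w := k.comm.trans (Category.assoc _ _ _) }
  invFun φ :=
    { f := φ.left
      comm := by
        have h : inv (stageMap τ V) ≫ φ.left = φ.right := by
          rw [IsIso.inv_comp_eq, stageMap_comp_right]
        rw [Category.assoc, h]
        exact φ.w }
  right_inv φ := stage_hom_ext (show inv (stageMap τ V) ≫ φ.left = φ.right by
    rw [IsIso.inv_comp_eq, stageMap_comp_right])

lemma bijective_left_comp_f {V W : Stage T} [IsIso V.hom] [IsIso (stageMap τ W)] (f : V ⟶ W)
    {B : PointedAlgebra T τ} (hf : Function.Bijective fun φ : W ⟶ B.stage => f ≫ φ) :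
    Function.Bijective fun k : algebraOfStage (τ := τ) W ⟶ B => f.left ≫ k.f :=
  ((bijective_left_of_isIso_hom B.stage).comp hf).comp (algebraOfStageHomEquiv W B).bijective

variable [HasCoequalizers D]

lemma bijective_toStageSucc_comp (V : Stage T) (B : PointedAlgebra T τ) :
    Function.Bijective fun ψ : stageSucc τ V ⟶ B.stage => toStageSucc τ V ≫ ψ := by
  refine ⟨fun ψ χ h => ?_, fun φ => ?_⟩
  · have hleft : ψ.left = χ.left := by
      rw [← stageMap_comp_right ψ, ← stageMap_comp_right χ]
      exact congrArg CommaMorphism.right h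
    have hψ : stageProj τ V ≫ ψ.right = T.map ψ.left ≫ B.str := ψ.w.symm
    have hχ : stageProj τ V ≫ χ.right = T.map χ.left ≫ B.str := χ.w.symm
    refine stage_hom_ext ((cancel_epi (stageProj τ V)).1 ?_)
    rw [hψ, hχ, hleft]
  · let r : V.right ⟶ B.carrier := φ.right
    have hr : stageMap τ V ≫ r = φ.left := stageMap_comp_right φ
    have hφ : V.hom ≫ r = T.map φ.left ≫ B.str := φ.w.symm
    obtain ⟨k, hk⟩ := exists_stageProj_comp_eq τ (T.map r ≫ B.str) (by
      rw [← hr, T.map_comp, Category.assoc] at hφ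
      have hτ : r ≫ τ.app B.carrier = τ.app V.right ≫ T.map r := τ.naturality r
      rw [← reassoc_of% hτ, B.unit, Category.comp_id, hφ])
    let ψ : stageSucc τ V ⟶ B.stage := { left := r, right := k, w := hk.symm }
    exact ⟨ψ, stage_hom_ext (stageMap_comp_right ψ)⟩

lemma isIso_toStageSucc (V : Stage T) [IsIso (stageMap τ V)] : IsIso (toStageSucc τ V) := by
  let a : T.obj V.left ⟶ V.right := V.hom
  let e : V.left ≅ V.right := asIso (stageMap τ V)
  have hτ : e.inv ≫ τ.app V.left = τ.app V.right ≫ T.map e.inv := τ.naturality _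
  have ha : τ.app V.right ≫ T.map e.inv ≫ a = 𝟙 V.right := by
    rw [← reassoc_of% hτ]
    exact e.inv_hom_id
  have hproj : a ≫ τ.app V.right ≫ stageProj τ V = T.map e.hom ≫ stageProj τ V :=
    stageProj_condition τ V
  obtain ⟨k, hk⟩ := exists_stageProj_comp_eq τ (T.map e.inv ≫ a) (by
    calc a ≫ τ.app V.right ≫ T.map e.inv ≫ a = a := by rw [ha, Category.comp_id]
      _ = T.map e.hom ≫ T.map e.inv ≫ a := by
        rw [← T.map_comp_assoc, e.hom_inv_id, T.map_id, Category.id_comp])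
  let e' : V.right ≅ (stageSucc τ V).right :=
    { hom := τ.app V.right ≫ stageProj τ V
      inv := k
      hom_inv_id := by rw [Category.assoc, hk, ha]
      inv_hom_id := by
        rw [← cancel_epi (stageProj τ V), reassoc_of% hk, hproj, ← T.map_comp_assoc, e.inv_hom_id,
          T.map_id, Category.id_comp, Category.comp_id] }
  exact (Comma.isoMk (Y := stageSucc τ V) e e' (toStageSucc τ V).w).isIso_hom

variable {A : D} {Y : Ordinal.{v} ⥤ Stage T} (hY : IsIteration (stageSuccStruct τ A) Y)

include hY

lemma bijective_map_comp (B : PointedAlgebra T τ) {β γ : Ordinal.{v}} (h : β ≤ γ) :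
    Function.Bijective fun ψ : Y.obj γ ⟶ B.stage => Y.map (homOfLE h) ≫ ψ :=
  hY.map_mem (ObjectProperty.ofObj (PointedAlgebra.stage (T := T) (τ := τ))).isLocal h
    (fun δ _ _ => by
      rintro _ ⟨B⟩
      exact bijective_toStageSucc_comp (Y.obj δ) B) _ ⟨B⟩

lemma isIso_map_of_isIso_stageMap {β γ : Ordinal.{v}} [IsIso (stageMap τ (Y.obj β))]
    (h : β ≤ γ) : IsIso (Y.map (homOfLE h)) := by
  induction γ using WellFoundedLT.induction with
  | ind γ ih =>
    refine hY.map_mem (MorphismProperty.isomorphisms _) h fun δ hβδ hδγ => ?_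
    have := ih δ hδγ hβδ
    have := isIso_stageMap_of_iso (τ := τ) (asIso (Y.map (homOfLE hβδ)))
    exact isIso_toStageSucc (Y.obj δ)

lemma exists_free_of_isIso_stageMap [HasColimits D] (β : Ordinal.{v})
    [IsIso (stageMap τ (Y.obj β))] :
    ∃ (S : FreeAlgebraSequence T τ A) (β : Ordinal.{v}) (B : PointedAlgebra T τ)
      (e : S.X.obj β ≅ B.carrier), S.ConvergesAt β ∧
      S.x β = T.map e.hom ≫ B.str ≫ e.inv ≫ S.X.map (homOfLE (Order.le_succ β)) ∧
      ∀ B' : PointedAlgebra T τ, Function.Bijective fun k : B ⟶ B' =>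
        (S.zero.hom ≫ S.X.map (homOfLE (zero_le : 0 ≤ β)) ≫ e.hom) ≫ k.f := by
  refine ⟨freeAlgebraSequence hY, β, algebraOfStage (Y.obj β), Iso.refl _, fun γ h => ?_, ?_,
    fun B => ?_⟩
  · have := isIso_map_of_isIso_stageMap hY h
    exact inferInstanceAs (IsIso ((Comma.fst T (𝟭 D)).map (Y.map (homOfLE h))))
  · calc (Y.obj β).hom ≫ (stageShift hY β).hom
        = 𝟙 _ ≫ ((Y.obj β).hom ≫ inv (stageMap τ (Y.obj β))) ≫ 𝟙 _ ≫
            (Y.map (homOfLE (Order.le_succ β))).left := by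
          rw [map_le_succ_left hY, Category.id_comp, Category.id_comp, Category.assoc,
            IsIso.inv_hom_id_assoc]
      _ = _ := congrArg (· ≫ _) (T.map_id _).symm
  · have := isIso_stage_zero hY
    let i : A ≅ (Y.obj 0).left := (freeAlgebraSequence hY).zero
    have hbij := bijective_left_comp_f _ (bijective_map_comp hY B (zero_le : 0 ≤ β))
    convert i.homFromEquiv.symm.bijective.comp hbij using 2 with k
    calc (i.hom ≫ (Y.map _).left ≫ 𝟙 _) ≫ k.f
        = i.hom ≫ (Y.map _).left ≫ k.f := by rw [Category.comp_id, Category.assoc]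

end Stage

theorem freeMonadExistsConstructively_of_isIso {D : Type u} [Category.{v} D] [HasColimits D]
    {T : D ⥤ D} {τ : 𝟭 D ⟶ T}
    (h : ∀ (A : D) (S : FreeAlgebraSequence T τ A), ∃ β : Ordinal.{v},
      IsIso (S.X.map (homOfLE (Order.le_succ β)))) :
    FreeMonadExistsConstructively T τ := by
  refine freeMonadExistsConstructively_of_free fun A => ?_
  have : HasColimits (Stage T) := ⟨fun _ _ => inferInstance⟩
  obtain ⟨Y, hY⟩ := exists_isIteration.{v} (stageSuccStruct τ A)
  obtain ⟨β, hβ⟩ := h A (freeAlgebraSequence hY)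
  have : IsIso (stageMap τ (Y.obj β) ≫ (stageShift hY β).hom) := by
    rw [← map_le_succ_left hY]
    exact hβ
  have : IsIso (stageMap τ (Y.obj β)) := IsIso.of_isIso_comp_right _ (stageShift hY β).hom
  exact exists_free_of_isIso_stageMap hY β

/-! ## Well-copowered factorization systems -/

section WellCopowered

variable {C : Type u} [Category.{v} C]

lemma llp_widePushout_head {M : MorphismProperty C} {ι : Type w} {A : C} {B : ι → C}
    {e : ∀ i, A ⟶ B i} [HasWidePushout A B e] (he : ∀ i, M.llp (e i)) :
    M.llp (WidePushout.head e) := by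
  intro X Y m hm
  refine ⟨fun {a b} sq => ?_⟩
  have hl (i : ι) : ∃ l : B i ⟶ X, e i ≫ l = a ∧ l ≫ m = WidePushout.ι e i ≫ b := by
    have := he i m hm
    have sq' : CommSq a (e i) m (WidePushout.ι e i ≫ b) :=
      ⟨by rw [sq.w, WidePushout.arrow_ι_assoc]⟩
    exact ⟨sq'.lift, sq'.fac_left, sq'.fac_right⟩
  choose l hl hl' using hl
  refine ⟨⟨⟨WidePushout.desc a l hl, WidePushout.head_desc e a l hl, ?_⟩⟩⟩
  apply WidePushout.hom_ext
  · intro i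
    rw [WidePushout.ι_desc_assoc, hl' i]
  · rw [WidePushout.head_desc_assoc, sq.w]

lemma IsWellCopowered.exists_family {E : MorphismProperty C} (hE : IsWellCopowered E) (X : C) :
    ∃ (ι : Type v) (Q : ι → Under X), ∀ {Z : C} (e : X ⟶ Z), E e →
      ∃ (i : ι) (j : Z ≅ (Q i).right), e ≫ j.hom = (Q i).hom := by
  obtain ⟨Q, _, hQ⟩ := (hE X).exists_small_le'
  refine ⟨Shrink.{v} (Subtype Q), fun i => ((equivShrink _).symm i).1, fun e he => ?_⟩
  obtain ⟨P, hP, ⟨j⟩⟩ := hQ (Under.mk e) he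
  obtain ⟨i, hi⟩ := (equivShrink (Subtype Q)).symm.surjective ⟨P, hP⟩
  obtain rfl : ((equivShrink _).symm i).1 = P := congrArg Subtype.val hi
  exact ⟨i, (Under.forget X).mapIso j, Under.w j.hom⟩

lemma injective_widePushout_desc_ite {κ : Type w} {A B Z : C} {e : A ⟶ B}
    [HasWidePushout A (fun _ : κ => B) fun _ => e] {p q : B ⟶ Z} (h : e ≫ p = e ≫ q) (hne : p ≠ q)
    [∀ (S : Set κ) (k : κ), Decidable (k ∈ S)] :
    Function.Injective fun S : Set κ =>
      WidePushout.desc (arrows := fun _ : κ => e) (e ≫ p) (fun k => if k ∈ S then p else q)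
        (fun k => by split_ifs <;> simp only [h]) := by
  intro S S' w
  ext k
  have hk : (if k ∈ S then p else q) = if k ∈ S' then p else q := by
    simpa only [WidePushout.ι_desc] using congrArg (WidePushout.ι (fun _ : κ => e) k ≫ ·) w
  by_cases hS : k ∈ S <;> by_cases hS' : k ∈ S' <;>
    simp only [hS, hS', if_true, if_false, hne, hne.symm] at hk ⊢

open scoped Classical in
/-- If `e ≫ p = e ≫ q` with `p ≠ q`, the cointersection of `κ` copies of `e` is an `M.llp`-quotient
with at least `2 ^ κ` maps to a fixed object, which is too many when `κ` counts all such maps out of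
`M.llp`-quotients. -/
theorem epi_of_isWellCopowered_llp [HasColimits C] {M : MorphismProperty C}
    (hM : IsWellCopowered M.llp) {A B : C} {e : A ⟶ B} (he : M.llp e) : Epi e := by
  refine ⟨fun {Z} p q hpq => ?_⟩
  by_contra hne
  obtain ⟨ι, Q, hQ⟩ := hM.exists_family A
  let κ : Type v := Σ i, ((Q i).right ⟶ Z)
  obtain ⟨i, j, -⟩ := hQ (WidePushout.head fun _ : κ => e)
    (llp_widePushout_head fun _ => he)
  have hj : Function.Injective fun a : widePushout A (fun _ : κ => B) (fun _ => e) ⟶ Z =>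
      (⟨i, j.inv ≫ a⟩ : κ) := fun a b hab =>
    (cancel_epi j.inv).1 (eq_of_heq (Sigma.mk.inj hab).2)
  exact Function.cantor_injective _ (hj.comp (injective_widePushout_desc_ite hpq hne))

theorem epi_of_isWellCopowered [HasColimits C] {E M : MorphismProperty C}
    [E.IsWeakFactorizationSystem M] (hE : IsWellCopowered E) {A B : C} {e : A ⟶ B} (he : E e) :
    Epi e := by
  rw [← MorphismProperty.llp_eq_of_wfs E M] at hE he
  exact epi_of_isWellCopowered_llp hE he

end WellCopowered

/-! ## Stabilization of images -/

section Stabilization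

open Filter in
lemma exists_frequently_of_eventually_exists {ι : Type v} {p : ι → Ordinal.{v} → Prop}
    (h : ∀ᶠ δ in atTop, ∃ i, p i δ) : ∃ i, ∃ᶠ δ in atTop, p i δ := by
  by_contra! hp
  simp only [eventually_atTop] at h hp
  choose f hf using hp
  obtain ⟨δ, hδ⟩ := h
  obtain ⟨i, hi⟩ := hδ (max δ (⨆ i, f i)) (le_max_left _ _)
  exact hf i _ ((Ordinal.le_iSup f i).trans (le_max_right _ _)) hi

variable {C : Type u} [Category.{v} C] [HasColimits C] {E : MorphismProperty C}

open Filter in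
/-- The images of `F β` in the `F δ` range over a set of quotients of `F β`, so that one of them
occurs for arbitrarily large `δ`. Since the images get smaller as `δ` increases, they are then
constant. -/
theorem exists_image_stable (M : MorphismProperty C) [E.IsWeakFactorizationSystem M]
    (hE : IsWellCopowered E) (F : Ordinal.{v} ⥤ C) (β : Ordinal.{v}) :
    ∃ (γ : Ordinal.{v}) (hβγ : β ≤ γ), ∀ (δ : Ordinal.{v}) (hγδ : γ ≤ δ) {Z : C}
      (e : F.obj β ⟶ Z) (m : Z ⟶ F.obj δ), E e →
      e ≫ m = F.map (homOfLE (hβγ.trans hγδ)) →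
      ∃ d : Z ⟶ F.obj γ, e ≫ d = F.map (homOfLE hβγ) ∧ d ≫ F.map (homOfLE hγδ) = m := by
  obtain ⟨ι, Q, hQ⟩ := hE.exists_family (F.obj β)
  let IsImage (i : ι) (δ : Ordinal.{v}) : Prop := ∃ (hβδ : β ≤ δ) (m : (Q i).right ⟶ F.obj δ),
    M m ∧ (Q i).hom ≫ m = F.map (homOfLE hβδ)
  obtain ⟨i, hi⟩ : ∃ i, ∃ᶠ δ in atTop, IsImage i δ := by
    refine exists_frequently_of_eventually_exists (eventually_atTop.2 ⟨β, fun δ hβδ => ?_⟩)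
    have : M.RespectsIso := by
      rw [← MorphismProperty.rlp_eq_of_wfs E M]
      infer_instance
    let fac := MorphismProperty.factorizationData E M (F.map (homOfLE hβδ))
    obtain ⟨i, j, hj⟩ := hQ fac.i fac.hi
    exact ⟨i, hβδ, j.inv ≫ fac.p, (MorphismProperty.cancel_left_of_respectsIso M _ _).2 fac.hp,
      by rw [← hj, Category.assoc, j.hom_inv_id_assoc, fac.fac]⟩
  rw [frequently_atTop] at hi
  obtain ⟨γ, -, hβγ, mγ, -, hmγ⟩ := hi β
  refine ⟨γ, hβγ, fun δ hγδ Z e m he hem => ?_⟩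
  obtain ⟨δ', hδδ', hβδ', m', hm', hem'⟩ := hi δ
  have sq : CommSq (Q i).hom e m' (m ≫ F.map (homOfLE hδδ')) :=
    ⟨by rw [hem', reassoc_of% hem, ← F.map_comp]; rfl⟩
  have := MorphismProperty.hasLiftingProperty_of_wfs e m' he hm'
  have hd : e ≫ sq.lift ≫ mγ = F.map (homOfLE hβγ) := by rw [sq.fac_left_assoc, hmγ]
  have := epi_of_isWellCopowered (M := M) hE he
  refine ⟨sq.lift ≫ mγ, hd, ?_⟩
  rw [← cancel_epi e, ← Category.assoc, hd, hem, ← F.map_comp]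
  rfl

end Stabilization

/-! ## Interleaved diagrams -/

section Interleaving

variable {J : Type w} [Preorder J] {D : Type u} [Category.{v} D]

lemma nonempty_isColimit_iff_bijective {F : J ⥤ D} (c : Cocone F) :
    Nonempty (IsColimit c) ↔
      ∀ W : D, Function.Bijective fun f : c.pt ⟶ W => c.ι ≫ (Functor.const J).map f := by
  refine ⟨fun ⟨hc⟩ W => hc.homEquiv.bijective, fun h => ?_⟩
  choose desc hdesc using fun s : Cocone F => (h s.pt).2 s.ι
  refine ⟨⟨desc, fun s i => congrArg (fun t => t.app i) (hdesc s), fun s f hf => ?_⟩⟩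
  refine (h s.pt).1 (Eq.trans ?_ (hdesc s).symm)
  ext i
  exact hf i

/-- The diagrams `X` and `Z` interleave along `a : X ⟶ Z` if each object of `Z` maps back to a later
object of `X`, compatibly with `a`. In other words, `a` is an isomorphism of ind-objects. -/
def Interleaves {X Z : J ⥤ D} (a : X ⟶ Z) : Prop :=
  ∀ i, ∃ (j : J) (h : i ≤ j) (d : Z.obj i ⟶ X.obj j),
    a.app i ≫ d = X.map (homOfLE h) ∧ d ≫ a.app j = Z.map (homOfLE h)

namespace Interleaves

variable {X Z : J ⥤ D} {a : X ⟶ Z}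

lemma whiskerRight (h : Interleaves a) {D' : Type u'} [Category.{v'} D'] (T : D ⥤ D') :
    Interleaves (Functor.whiskerRight a T) := by
  intro i
  obtain ⟨j, hij, d, hd, hd'⟩ := h i
  refine ⟨j, hij, T.map d, ?_, ?_⟩
  · exact (T.map_comp _ _).symm.trans (congrArg T.map hd)
  · exact (T.map_comp _ _).symm.trans (congrArg T.map hd')

variable [IsDirectedOrder J]

lemma bijective_comp (h : Interleaves a) (W : D) :
    Function.Bijective fun s : Z ⟶ (Functor.const J).obj W => a ≫ s := by
  choose j hj d hd hd' using h
  constructor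
  · intro s s' hs
    ext i
    have hZ (s : Z ⟶ (Functor.const J).obj W) : s.app i = d i ≫ (a ≫ s).app (j i) :=
      calc s.app i = Z.map (homOfLE (hj i)) ≫ s.app (j i) :=
            ((Cocone.mk W s).w (homOfLE (hj i))).symm
        _ = d i ≫ (a ≫ s).app (j i) := by rw [← hd', Category.assoc, NatTrans.comp_app]
    rw [hZ s, hZ s']
    exact congrArg (fun t => d i ≫ t.app (j i)) hs
  · intro t
    have ht {i k : J} (hik : i ≤ k) : X.map (homOfLE hik) ≫ t.app k = t.app i :=
      (Cocone.mk W t).w (homOfLE hik)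
    have key (i k : J) (hk : j i ≤ k) : d i ≫ t.app (j i) =
        Z.map (homOfLE ((hj i).trans hk)) ≫ d k ≫ t.app (j k) :=
      calc d i ≫ t.app (j i) = d i ≫ X.map (homOfLE hk) ≫ a.app k ≫ d k ≫ t.app (j k) := by
            rw [reassoc_of% hd, ht, ht]
        _ = Z.map (homOfLE (hj i)) ≫ Z.map (homOfLE hk) ≫ d k ≫ t.app (j k) := by
            rw [a.naturality_assoc, reassoc_of% hd']
        _ = Z.map (homOfLE ((hj i).trans hk)) ≫ d k ≫ t.app (j k) := by
            rw [← Z.map_comp_assoc, homOfLE_comp]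
    refine ⟨{ app i := d i ≫ t.app (j i), naturality := fun i i' f => ?_ }, ?_⟩
    · obtain ⟨k, hk, hk'⟩ := exists_ge_ge (j i) (j i')
      refine Eq.trans ?_ (Category.comp_id _).symm
      rw [key i k hk, key i' k hk', ← Z.map_comp_assoc]
      rfl
    · ext i
      exact (Category.assoc _ _ _).symm.trans ((congrArg (· ≫ _) (hd i)).trans (ht (hj i)))

lemma nonempty_isColimit_precompose_iff (h : Interleaves a) (c : Cocone Z) :
    Nonempty (IsColimit ((Cocone.precompose a).obj c)) ↔ Nonempty (IsColimit c) := by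
  rw [nonempty_isColimit_iff_bijective, nonempty_isColimit_iff_bijective]
  refine forall_congr' fun W => ?_
  rw [← Function.Bijective.of_comp_iff' (h.bijective_comp W)]
  exact iff_of_eq (congrArg _ (funext fun f => Category.assoc _ _ _))

lemma nonempty_isColimit_mapCocone_iff (h : Interleaves a) {D' : Type u'} [Category.{v'} D']
    (T : D ⥤ D') (c : Cocone Z) :
    Nonempty (IsColimit (T.mapCocone ((Cocone.precompose a).obj c))) ↔
      Nonempty (IsColimit (T.mapCocone c)) := by
  rw [← (h.whiskerRight T).nonempty_isColimit_precompose_iff]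
  exact (IsColimit.equivIsoColimit (Functor.mapCoconePrecompose T)).nonempty_congr

end Interleaves

end Interleaving

/-! ## Colimits of sequences with stable images -/

section StableImages

variable {C : Type u} [Category.{v} C] {E M : MorphismProperty C}

lemma IsOrthogonalFactorizationSystem.exists_levelwise_factorization
    (h : IsOrthogonalFactorizationSystem E M) {J : Type w} [Category.{v'} J] {G H : J ⥤ C}
    (φ : G ⟶ H) : ∃ (Z : J ⥤ C) (e : G ⟶ Z) (m : Z ⟶ H),
      e ≫ m = φ ∧ (∀ j, E (e.app j)) ∧ ∀ j, M (m.app j) := by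
  have := h.isWeakFactorizationSystem
  let fac (j : J) := MorphismProperty.factorizationData E M (φ.app j)
  have hu {i j : J} (f : i ⟶ j) : ∃ u : (fac i).Z ⟶ (fac j).Z,
      (fac i).i ≫ u = G.map f ≫ (fac j).i ∧ u ≫ (fac j).p = (fac i).p ≫ H.map f := by
    have := MorphismProperty.hasLiftingProperty_of_wfs _ _ (fac i).hi (fac j).hp
    have sq : CommSq (G.map f ≫ (fac j).i) (fac i).i (fac j).p ((fac i).p ≫ H.map f) :=
      ⟨by rw [Category.assoc, (fac j).fac, (fac i).fac_assoc, φ.naturality]⟩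
    exact ⟨sq.lift, sq.fac_left, sq.fac_right⟩
  choose u hiu hup using @hu
  let Z : J ⥤ C :=
    { obj j := (fac j).Z
      map f := u f
      map_id j := h.lift_unique (fac j).hi (fac j).hp _ _ (by simp [hiu]) (by simp [hup])
      map_comp {i j k} f g := h.lift_unique (fac i).hi (fac k).hp _ _
        (by simp only [hiu, reassoc_of% hiu, G.map_comp, Category.assoc])
        (by simp only [hup, reassoc_of% hup, H.map_comp, Category.assoc]) }
  exact ⟨Z, { app j := (fac j).i, naturality i j f := (hiu f).symm },
    { app j := (fac j).p, naturality i j f := hup f }, by ext j; exact (fac j).fac,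
    fun j => (fac j).hi, fun j => (fac j).hp⟩

lemma IsOrthogonalFactorizationSystem.exists_interleaves
    (hEM : IsOrthogonalFactorizationSystem E M) {J : Type w} [Preorder J] {X : J ⥤ Arrow C}
    (c : Cocone X) (hr : ∀ i, IsIso (c.ι.app i).right)
    (hstable : ∀ i, ∃ (j : J) (hij : i ≤ j), ∀ {Z : C} (e : (X.obj i).left ⟶ Z)
      (m : Z ⟶ c.pt.left), E e → e ≫ m = (c.ι.app i).left →
        ∃ d : Z ⟶ (X.obj j).left,
          e ≫ d = (X.map (homOfLE hij)).left ∧ d ≫ (c.ι.app j).left = m) :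
    ∃ (G : J ⥤ Over c.pt.right) (L : Cocone G) (a : X ⟶ G ⋙ overToArrow c.pt.right),
      Interleaves a ∧ (∀ i, M (L.ι.app i).left) ∧
        Nonempty (c ≅ (Cocone.precompose a).obj ((overToArrow c.pt.right).mapCocone L)) := by
  obtain ⟨Z, e, m, hem, he, hm⟩ :=
    hEM.exists_levelwise_factorization (Arrow.leftFunc.mapCocone c).ι
  let r (i) : (X.obj i).right ≅ c.pt.right := @asIso _ _ _ _ (c.ι.app i).right (hr i)
  let l (i) : (X.obj i).left ⟶ c.pt.left := (c.ι.app i).left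
  have hem (i) : e.app i ≫ m.app i = l i := congrArg (fun φ => φ.app i) hem
  have hw (i) : l i ≫ c.pt.hom = (X.obj i).hom ≫ (r i).hom := (c.ι.app i).w
  have hXr {i j} (f : i ⟶ j) : (X.map f).right ≫ (r j).hom = (r i).hom :=
    congrArg Arrow.Hom.right (c.w f)
  let c' : Cocone Z := ⟨c.pt.left, m⟩
  let L := Over.liftCocone c' c.pt.hom
  let a : X ⟶ Over.lift Z (m ≫ (Functor.const _).map c.pt.hom) ⋙ overToArrow c.pt.right :=
    { app i := Arrow.homMk (e.app i) (r i).hom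
        ((Category.assoc _ _ _).symm.trans
          ((congrArg (· ≫ c.pt.hom) (hem i)).trans (hw i)))
      naturality i j f := by
        ext
        · exact e.naturality f
        · exact (hXr f).trans (Category.comp_id _).symm }
  have ha : Interleaves a := by
    intro i
    obtain ⟨j, hij, hj⟩ := hstable i
    obtain ⟨d, hd, hdm⟩ := hj (e.app i) (m.app i) (he i) (hem i)
    have hdw : (d ≫ (X.obj j).hom) ≫ (r j).hom = m.app i ≫ c.pt.hom :=
      calc (d ≫ (X.obj j).hom) ≫ (r j).hom = d ≫ l j ≫ c.pt.hom := by rw [hw, Category.assoc]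
        _ = (d ≫ l j) ≫ c.pt.hom := (Category.assoc _ _ _).symm
        _ = m.app i ≫ c.pt.hom := congrArg (· ≫ c.pt.hom) hdm
    refine ⟨j, hij, Arrow.homMk d (r j).inv ((Iso.eq_comp_inv _).2 hdw), ?_, ?_⟩
    · ext
      · exact hd
      · exact (Iso.comp_inv_eq _).2 (hXr _).symm
    · ext
      · refine hEM.lift_unique (he i) (hm j) (d ≫ e.app j) (Z.map (homOfLE hij)) ?_ ?_
        · exact (Category.assoc _ _ _).symm.trans
            ((congrArg (· ≫ e.app j) hd).trans (e.naturality _))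
        · exact (Category.assoc _ _ _).trans
            ((congrArg (d ≫ ·) (hem j)).trans (hdm.trans (c'.w (homOfLE hij)).symm))
      · exact (r j).inv_hom_id
  refine ⟨_, L, a, ha, hm, ⟨Cocone.ext (Iso.refl _) fun i => ?_⟩⟩
  ext
  · exact (Category.comp_id _).trans (hem i).symm
  · exact (Category.comp_id _).trans (Category.comp_id (r i).hom).symm

/-- The images of the `X i` in the colimit interleave with the `X i`, so that they have the same
colimit, both before and after applying `T`. -/
theorem PreservesMColimits.nonempty_isColimit_mapCocone (hEM : IsOrthogonalFactorizationSystem E M)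
    {α : Cardinal.{v}} {D : Type u'} [Category.{v'} D] {T : Arrow C ⥤ D}
    (hT : PreservesMColimits M α T) {X : α.ord.ToType ⥤ Arrow C} (c : Cocone X)
    (hc : IsColimit (Arrow.leftFunc.mapCocone c)) (hr : ∀ i, IsIso (c.ι.app i).right)
    (hstable : ∀ i, ∃ (j : α.ord.ToType) (hij : i ≤ j), ∀ {Z : C} (e : (X.obj i).left ⟶ Z)
      (m : Z ⟶ c.pt.left), E e → e ≫ m = (c.ι.app i).left →
        ∃ d : Z ⟶ (X.obj j).left,
          e ≫ d = (X.map (homOfLE hij)).left ∧ d ≫ (c.ι.app j).left = m) :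
    Nonempty (IsColimit (T.mapCocone c)) := by
  obtain ⟨_, L, a, ha, hm, ⟨k⟩⟩ := hEM.exists_interleaves c hr hstable
  have hZ : Nonempty (IsColimit ((Over.forget c.pt.right).mapCocone L)) :=
    (ha.nonempty_isColimit_mapCocone_iff Arrow.leftFunc _).1
      ⟨hc.ofIsoColimit ((Cocone.functoriality _ Arrow.leftFunc).mapIso k)⟩
  obtain ⟨hTL⟩ := (ha.nonempty_isColimit_mapCocone_iff T
    ((overToArrow c.pt.right).mapCocone L)).2 (hT _ _ L hZ hm)
  exact ⟨hTL.ofIsoColimit ((Cocone.functoriality _ T).mapIso k.symm)⟩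

end StableImages

/-! ## Cofinal chains of ordinals -/

section CofinalChains

lemma exists_isNormal_forall_lt_succ (g : Ordinal.{v} → Ordinal.{v}) :
    ∃ b : Ordinal.{v} → Ordinal.{v}, Order.IsNormal b ∧ ∀ i, g (b i) < b (Order.succ i) := by
  let b (o : Ordinal.{v}) : Ordinal.{v} :=
    Ordinal.limitRecOn o 0 (fun _ x => Order.succ (max x (g x)))
      (fun o _ ih => ⨆ a : Set.Iio o, ih a a.2)
  have hsucc (i) : b (Order.succ i) = Order.succ (max (b i) (g (b i))) := by
    rw [Order.succ_eq_add_one]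
    exact Ordinal.limitRecOn_add_one ..
  have hlim {o : Ordinal.{v}} (ho : Order.IsSuccLimit o) : b o = ⨆ a : Set.Iio o, b a :=
    Ordinal.limitRecOn_limit _ _ _ _ ho
  refine ⟨b, Order.IsNormal.of_succ_lt (fun i => ?_) fun {o} ho => ?_, fun i => ?_⟩
  · rw [hsucc, Order.lt_succ_iff]
    exact le_max_left _ _
  · rw [hlim ho, Set.image_eq_range]
    have : Nonempty (Set.Iio o) := ⟨⟨0, ho.bot_lt⟩⟩
    exact isLUB_ciSup (Ordinal.bddAbove_of_small)
  · rw [hsucc, Order.lt_succ_iff]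
    exact le_max_right _ _

lemma exists_cofinal_chain (g : Ordinal.{v} → Ordinal.{v}) {o : Ordinal.{v}}
    (ho : Order.IsSuccLimit o) : ∃ l : Ordinal.{v}, Order.IsSuccLimit l ∧
      ∃ φ : o.ToType →o Set.Iio l, (∀ β, ∃ j, β ≤ φ j) ∧ ∀ j, ∃ k, j ≤ k ∧ g (φ j) ≤ φ k := by
  obtain ⟨b, hb, hg⟩ := exists_isNormal_forall_lt_succ g
  refine ⟨b o, hb.map_isSuccLimit ho,
    ⟨fun j => ⟨b (Ordinal.ToType.mk.symm j), hb.strictMono (Ordinal.ToType.mk.symm j).2⟩,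
      fun i j hij => hb.strictMono.monotone (Ordinal.ToType.mk.symm.monotone hij)⟩, ?_, ?_⟩
  · rintro ⟨β, hβ⟩
    obtain ⟨i, hi, hβi⟩ := (hb.lt_iff_exists_lt ho).1 hβ
    refine ⟨Ordinal.ToType.mk ⟨i, hi⟩, hβi.le.trans_eq (congrArg b ?_)⟩
    rw [OrderIso.symm_apply_apply]
  · intro j
    let i := Ordinal.ToType.mk.symm j
    have hi : Order.succ i.1 < o := ho.succ_lt (Set.mem_Iio.1 i.2)
    refine ⟨Ordinal.ToType.mk ⟨Order.succ i.1, hi⟩, ?_, (hg i).le.trans_eq (congrArg b ?_)⟩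
    · rw [← OrderIso.symm_apply_le]
      exact Order.le_succ i.1
    · rw [OrderIso.symm_apply_apply]

end CofinalChains

/-! ## Stationarity of Kelly's sequence -/

section Stationarity

variable {D : Type u} [Category.{v} D] {T : D ⥤ D} {τ : 𝟭 D ⟶ T} {A : D}
  (S : FreeAlgebraSequence T τ A)

namespace FreeAlgebraSequence

lemma map_comp_x {β γ : Ordinal.{v}} (h : β ≤ γ) :
    T.map (S.X.map (homOfLE h)) ≫ S.x γ =
      S.x β ≫ S.X.map (homOfLE (Order.succ_le_succ h)) := by
  induction γ using WellFoundedLT.induction with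
  | ind γ ih =>
    obtain rfl | hβγ := h.eq_or_lt
    · simp [homOfLE_refl]
    obtain rfl | ⟨γ, rfl⟩ | hγ := γ.zero_or_succ_or_isSuccLimit
    · exact absurd hβγ not_lt_zero
    · have hβγ := Order.le_of_lt_succ hβγ
      calc T.map (S.X.map (homOfLE h)) ≫ S.x (Order.succ γ)
          = T.map (S.X.map (homOfLE hβγ)) ≫ (S.x γ ≫ τ.app _) ≫ S.x (Order.succ γ) := by
            rw [S.condition_succ, ← T.map_comp_assoc, ← S.X.map_comp, homOfLE_comp]
        _ = S.x β ≫ S.X.map (homOfLE (Order.succ_le_succ h)) := by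
            rw [Category.assoc, S.unit_x, reassoc_of% (ih γ (Order.lt_succ γ) hβγ),
              ← S.X.map_comp, homOfLE_comp]
    · rw [S.condition_limit γ hγ β hβγ, Category.assoc, Category.assoc, S.unit_x,
        ← S.X.map_comp, homOfLE_comp]

theorem isIso_map_succ_of_isColimit {l : Ordinal.{v}} (hl : Order.IsSuccLimit l)
    (hT : IsColimit (T.mapCocone ((Set.principalSegIio l).cocone S.X))) :
    IsIso (S.X.map (homOfLE (Order.le_succ l))) := by
  have := S.isWellOrderContinuous
  let c : Cocone (((Set.principalSegIio l).monotone.functor ⋙ S.X) ⋙ T) :=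
    { pt := S.X.obj l
      ι :=
        { app β := S.x β ≫ S.X.map (homOfLE (Order.succ_le_of_lt β.2))
          naturality β γ f := by
            refine Eq.trans ?_ (Category.comp_id _).symm
            refine ((reassoc_of% S.map_comp_x (leOfHom f)) _).trans (congrArg (S.x β ≫ ·) ?_)
            rw [← S.X.map_comp, homOfLE_comp] } }
  let s : T.obj (S.X.obj l) ⟶ S.X.obj l := hT.desc c
  have hs (β : Ordinal.{v}) (hβ : β < l) : T.map (S.X.map (homOfLE hβ.le)) ≫ s =
      S.x β ≫ S.X.map (homOfLE (Order.succ_le_of_lt hβ)) := hT.fac c ⟨β, hβ⟩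
  have hτs : τ.app (S.X.obj l) ≫ s = 𝟙 (S.X.obj l) := by
    refine hom_ext_of_isSuccLimit S.X hl fun β hβ => ?_
    calc S.X.map (homOfLE hβ.le) ≫ τ.app (S.X.obj l) ≫ s
        = τ.app (S.X.obj β) ≫ T.map (S.X.map (homOfLE hβ.le)) ≫ s := τ.naturality_assoc _ _
      _ = S.X.map (homOfLE hβ.le) ≫ 𝟙 _ := by
        rw [hs β hβ, ← Category.assoc, S.unit_x, ← S.X.map_comp, homOfLE_comp, Category.comp_id]
  obtain ⟨k, hk, -⟩ := S.existsUnique_limit l hl s fun β hβ => by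
    rw [hs β hβ, Category.assoc, Category.assoc, hτs, Category.comp_id]
  refine ⟨k, ?_, ?_⟩
  · rw [← S.unit_x, Category.assoc, hk, hτs]
  · refine (S.existsUnique_limit l hl (S.x l) (S.condition_limit l hl)).unique ?_
      (Category.comp_id _)
    refine hT.hom_ext fun ⟨β, hβ⟩ => ?_
    have hβ : β < l := hβ
    calc T.map (S.X.map (homOfLE hβ.le)) ≫ S.x l ≫ k ≫ S.X.map (homOfLE (Order.le_succ l))
        = T.map (S.X.map (homOfLE hβ.le)) ≫ S.x l := by
          rw [reassoc_of% hk, reassoc_of% (hs β hβ), S.map_comp_x, ← S.X.map_comp, homOfLE_comp]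

end FreeAlgebraSequence

end Stationarity

/-! ## Kelly's sequence of a codomain-preserving pointed endofunctor -/

section RightComponents

variable {C : Type u} [Category.{v} C]

section

variable [HasColimits C]

instance preservesWellOrderContinuousOfShape_leftFunc :
    PreservesWellOrderContinuousOfShape Ordinal.{v} (Arrow.leftFunc : Arrow C ⥤ C) where
  preservesColimitsOfShape l _ := by
    have : HasColimitsOfShape (Set.Iio l) C := hasColimitsOfShape_of_essentiallySmall.{v} _ _
    infer_instance

instance preservesWellOrderContinuousOfShape_rightFunc :
    PreservesWellOrderContinuousOfShape Ordinal.{v} (Arrow.rightFunc : Arrow C ⥤ C) where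
  preservesColimitsOfShape l _ := by
    have : HasColimitsOfShape (Set.Iio l) C := hasColimitsOfShape_of_essentiallySmall.{v} _ _
    infer_instance

end

/-- The identity arrow on `W` is cofree on `W` with respect to the codomain functor. -/
def homArrowIdEquiv (P : Arrow C) (W : C) : (P ⟶ Arrow.mk (𝟙 W)) ≃ (P.right ⟶ W) where
  toFun k := k.right
  invFun r := Arrow.homMk (P.hom ≫ r) r (Category.comp_id _)
  left_inv k := by
    ext
    · exact k.w.symm.trans (Category.comp_id k.left)
    · rfl
  right_inv _ := rfl

lemma comp_eq_comp_of_right_eq {P Q : Arrow C} {f g : P ⟶ Q} (hfg : f.right = g.right) {W : C}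
    (k : Q ⟶ Arrow.mk (𝟙 W)) : f ≫ k = g ≫ k :=
  (homArrowIdEquiv P W).injective (congrArg (· ≫ k.right) hfg)

lemma isIso_right_of_bijective {P Q : Arrow C} (y : P ⟶ Q)
    (hy : ∀ W : C, Function.Bijective fun k : Q ⟶ Arrow.mk (𝟙 W) => y ≫ k) : IsIso y.right := by
  refine isIso_of_coyoneda_map_bijective y.right fun W => ?_
  rw [← Function.Bijective.of_comp_iff _ (homArrowIdEquiv Q W).bijective]
  exact (homArrowIdEquiv P W).bijective.comp (hy W)

namespace FreeAlgebraSequence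

variable {T : Arrow C ⥤ Arrow C} {τ : 𝟭 (Arrow C) ⟶ T} {A : Arrow C}
  (S : FreeAlgebraSequence T τ A)

lemma right_map_eq (hτ : ∀ f, IsIso (τ.app f).right) {β γ : Ordinal.{v}} (h : β < γ) :
    (T.map (S.X.map (homOfLE h.le))).right =
      (S.x β ≫ S.X.map (homOfLE (Order.succ_le_of_lt h)) ≫ τ.app (S.X.obj γ)).right := by
  have := hτ (S.X.obj β)
  rw [← cancel_epi (τ.app (S.X.obj β)).right]
  have h : τ.app (S.X.obj β) ≫ T.map (S.X.map (homOfLE h.le)) = τ.app (S.X.obj β) ≫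
      S.x β ≫ S.X.map (homOfLE (Order.succ_le_of_lt h)) ≫ τ.app (S.X.obj γ) := by
    rw [reassoc_of% S.unit_x, ← S.X.map_comp_assoc, homOfLE_comp]
    exact (τ.naturality _).symm
  exact congrArg Arrow.Hom.right h

lemma isIso_x_right (hτ : ∀ f, IsIso (τ.app f).right) (β : Ordinal.{v}) :
    IsIso (S.x β).right := by
  obtain rfl | ⟨β, rfl⟩ | hβ := β.zero_or_succ_or_isSuccLimit
  · have := S.isIso_x_zero
    exact inferInstanceAs (IsIso (Arrow.rightFunc.map (S.x 0)))
  · obtain ⟨hx⟩ := S.isColimit_succ β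
    have : Epi (S.x (Order.succ β)) := Cofork.IsColimit.epi hx
    refine isIso_right_of_bijective _ fun W => ⟨fun k k' => (cancel_epi (S.x _)).1, fun h => ?_⟩
    have hid : S.X.map (homOfLE (Order.succ_le_of_lt (Order.lt_succ β))) = 𝟙 _ := S.X.map_id _
    have hfg : (S.x β ≫ τ.app (S.X.obj (Order.succ β))).right =
        (T.map (S.X.map (homOfLE (Order.le_succ β)))).right := by
      rw [S.right_map_eq hτ (Order.lt_succ β), hid, Category.id_comp]
    exact ⟨_, (Cofork.IsColimit.desc' hx h (comp_eq_comp_of_right_eq hfg h)).2⟩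
  · refine isIso_right_of_bijective _ fun W => (Function.bijective_iff_existsUnique _).2 fun h => ?_
    exact S.existsUnique_limit β hβ h fun γ hγ =>
      comp_eq_comp_of_right_eq (S.right_map_eq hτ hγ) h

lemma isIso_map_right [HasColimits C] (hτ : ∀ f, IsIso (τ.app f).right) {β γ : Ordinal.{v}}
    (h : β ≤ γ) : IsIso (S.X.map (homOfLE h)).right := by
  have := S.isWellOrderContinuous
  refine map_mem_of_map_succ_mem (MorphismProperty.isomorphisms C) (S.X ⋙ Arrow.rightFunc) h
    fun δ _ _ => ?_
  have := hτ (S.X.obj δ)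
  have := S.isIso_x_right hτ δ
  change IsIso (Arrow.rightFunc.map _)
  rw [← S.unit_x, Functor.map_comp]
  exact inferInstanceAs (IsIso ((τ.app _).right ≫ (S.x δ).right))

end FreeAlgebraSequence

end RightComponents

/-! ## The general convergence theorem -/

section Convergence

variable {C : Type u} [Category.{v} C] [HasColimits C]

lemma exists_cofinal_chain_image_stable {E : MorphismProperty C} (M : MorphismProperty C)
    [E.IsWeakFactorizationSystem M] (hE : IsWellCopowered E) (F : Ordinal.{v} ⥤ C)
    {o : Ordinal.{v}} (ho : Order.IsSuccLimit o) :
    ∃ l : Ordinal.{v}, Order.IsSuccLimit l ∧ ∃ φ : o.ToType →o Set.Iio l, (∀ β, ∃ i, β ≤ φ i) ∧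
      ∀ i, ∃ (j : o.ToType) (hij : i ≤ j), ∀ {Z : C} (e : F.obj (φ i) ⟶ Z) (m : Z ⟶ F.obj l),
        E e → e ≫ m = F.map (homOfLE (φ i).2.le) → ∃ d : Z ⟶ F.obj (φ j),
          e ≫ d = F.map (homOfLE (φ.monotone hij)) ∧ d ≫ F.map (homOfLE (φ j).2.le) = m := by
  choose g hg hstable using exists_image_stable M hE F
  obtain ⟨l, hl, φ, hφ, hgφ⟩ := exists_cofinal_chain g ho
  refine ⟨l, hl, φ, hφ, fun i => ?_⟩
  obtain ⟨j, hij, hj⟩ := hgφ i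
  refine ⟨j, hij, fun e m he hem => ?_⟩
  obtain ⟨d, hed, hdm⟩ := hstable _ l (hj.trans (φ j).2.le) e m he hem
  refine ⟨d ≫ F.map (homOfLE hj), ?_, ?_⟩
  · rw [reassoc_of% hed, ← F.map_comp, homOfLE_comp]
  · rw [Category.assoc, ← F.map_comp, homOfLE_comp, hdm]

theorem PreservesMColimits.exists_isColimit_mapCocone_cocone {E M : MorphismProperty C}
    (hEM : IsOrthogonalFactorizationSystem E M) (hE : IsWellCopowered E) {α : Cardinal.{v}}
    (hα : Cardinal.aleph0 ≤ α) {D : Type u'} [Category.{v'} D] {T : Arrow C ⥤ D}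
    (hT : PreservesMColimits M α T) (F : Ordinal.{v} ⥤ Arrow C)
    [(F ⋙ Arrow.leftFunc).IsWellOrderContinuous]
    (hr : ∀ {β γ : Ordinal.{v}} (h : β ≤ γ), IsIso (F.map (homOfLE h)).right) :
    ∃ l : Ordinal.{v}, Order.IsSuccLimit l ∧
      Nonempty (IsColimit (T.mapCocone ((Set.principalSegIio l).cocone F))) := by
  have := hEM.isWeakFactorizationSystem
  obtain ⟨l, hl, φ, hφ, hstable⟩ := exists_cofinal_chain_image_stable M hE (F ⋙ Arrow.leftFunc)
    (Cardinal.isSuccLimit_ord hα)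
  have : φ.monotone.functor.Final := (Monotone.final_functor_iff _).2 hφ
  let c := ((Set.principalSegIio l).cocone F).whisker φ.monotone.functor
  have hc : IsColimit (Arrow.leftFunc.mapCocone c) :=
    (Functor.Final.isColimitWhiskerEquiv φ.monotone.functor _).symm
      ((F ⋙ Arrow.leftFunc).isColimitOfIsWellOrderContinuous l hl)
  obtain ⟨hTc⟩ := hT.nonempty_isColimit_mapCocone hEM c hc (fun i => hr (φ i).2.le) hstable
  exact ⟨l, hl, ⟨Functor.Final.isColimitWhiskerEquiv φ.monotone.functor _ hTc⟩⟩

theorem SmallnessCondition.freeMonadExistsConstructively {T : Arrow C ⥤ Arrow C}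
    (hT : SmallnessCondition T) {τ : 𝟭 (Arrow C) ⟶ T} (hτ : ∀ f, IsIso (τ.app f).right) :
    FreeMonadExistsConstructively T τ := by
  obtain ⟨E, M, hEM, hE, α, hα, hT⟩ := hT
  refine freeMonadExistsConstructively_of_isIso fun A S => ?_
  have := S.isWellOrderContinuous
  obtain ⟨l, hl, ⟨hTl⟩⟩ := hT.exists_isColimit_mapCocone_cocone hEM hE hα.aleph0_le S.X
    fun h => S.isIso_map_right hτ h
  exact ⟨l, S.isIso_map_succ_of_isColimit hl hTl⟩

end Convergence

/-! ## Colimits over a fixed codomain -/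

section PreservesMColimits

theorem nonempty_isColimit_mapCocone_of_isPushout {A : Type u} [Category.{v} A] {D : Type u'}
    [Category.{v'} D] {F G H P : A ⥤ D} {a : F ⟶ G} {b : F ⟶ H} {g : G ⟶ P} {h : H ⟶ P}
    (hP : ∀ X, IsPushout (a.app X) (b.app X) (g.app X) (h.app X)) {J : Type*} [Category* J]
    {K : J ⥤ A} {c : Cocone K} (hF : IsColimit (F.mapCocone c)) (hG : IsColimit (G.mapCocone c))
    (hH : IsColimit (H.mapCocone c)) : Nonempty (IsColimit (P.mapCocone c)) := by
  let q (j) : K.obj j ⟶ c.pt := c.ι.app j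
  let dG (s : Cocone (K ⋙ P)) : G.obj c.pt ⟶ s.pt :=
    hG.desc ((Cocone.precompose (Functor.whiskerLeft K g)).obj s)
  let dH (s : Cocone (K ⋙ P)) : H.obj c.pt ⟶ s.pt :=
    hH.desc ((Cocone.precompose (Functor.whiskerLeft K h)).obj s)
  have hdG (s j) : G.map (q j) ≫ dG s = g.app (K.obj j) ≫ s.ι.app j := hG.fac _ j
  have hdH (s j) : H.map (q j) ≫ dH s = h.app (K.obj j) ≫ s.ι.app j := hH.fac _ j
  have w (s) : a.app c.pt ≫ dG s = b.app c.pt ≫ dH s := by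
    refine hF.hom_ext fun j => ?_
    calc F.map (q j) ≫ a.app c.pt ≫ dG s
        = a.app _ ≫ g.app _ ≫ s.ι.app j := by rw [a.naturality_assoc, hdG]
      _ = F.map (q j) ≫ b.app c.pt ≫ dH s := by
          rw [b.naturality_assoc, hdH]
          exact (hP _).w_assoc _
  refine ⟨{ desc s := (hP c.pt).desc (dG s) (dH s) (w s), fac s j := ?_, uniq s m hm := ?_ }⟩
  · change P.map (q j) ≫ (hP c.pt).desc _ _ (w s) = s.ι.app j
    refine (hP (K.obj j)).hom_ext ?_ ?_
    · rw [← g.naturality_assoc, (hP c.pt).inl_desc, hdG]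
    · rw [← h.naturality_assoc, (hP c.pt).inr_desc, hdH]
  · replace hm (j) : P.map (q j) ≫ m = s.ι.app j := hm j
    refine (hP c.pt).hom_ext ?_ ?_
    · rw [(hP c.pt).inl_desc]
      refine hG.hom_ext fun j => ?_
      change G.map (q j) ≫ g.app c.pt ≫ m = G.map (q j) ≫ dG s
      rw [g.naturality_assoc, hm, hdG]
    · rw [(hP c.pt).inr_desc]
      refine hH.hom_ext fun j => ?_
      change H.map (q j) ≫ h.app c.pt ≫ m = H.map (q j) ≫ dH s
      rw [h.naturality_assoc, hm, hdH]

def isColimitOfIsIso {J : Type w} [Category.{v'} J] [IsConnected J] {D : Type u} [Category.{v} D]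
    {F : J ⥤ D} (c : Cocone F) [IsIso c.ι] : IsColimit c :=
  ((IsColimit.precomposeHomEquiv (asIso c.ι) _).symm (isColimitConstCocone J c.pt)).ofIsoColimit
    (Cocone.ext (Iso.refl _) fun j => by simp [constCocone])

variable {C : Type u} [Category.{v} C] {M : MorphismProperty C} {α : Cardinal.{v}}

lemma preservesMColimits_leftFunc : PreservesMColimits M α (Arrow.leftFunc : Arrow C ⥤ C) :=
  fun _ _ _ h _ => h

namespace PreservesMColimits

variable {D : Type u'} [Category.{v'} D]

lemma comp {D' : Type*} [Category* D'] {F : Arrow C ⥤ D} (hF : PreservesMColimits M α F)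
    (G : D ⥤ D') [PreservesColimitsOfShape α.ord.ToType G] : PreservesMColimits M α (F ⋙ G) :=
  fun Y f c hc hM => (hF Y f c hc hM).map fun h =>
    isColimitOfPreserves (c := (overToArrow Y ⋙ F).mapCocone c) G h

lemma of_isPushout {F G H P : Arrow C ⥤ D} {a : F ⟶ G} {b : F ⟶ H} {g : G ⟶ P} {h : H ⟶ P}
    (hP : ∀ f, IsPushout (a.app f) (b.app f) (g.app f) (h.app f))
    (hF : PreservesMColimits M α F) (hG : PreservesMColimits M α G)
    (hH : PreservesMColimits M α H) : PreservesMColimits M α P := by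
  intro Y f c hc hM
  obtain ⟨hF⟩ := hF Y f c hc hM
  obtain ⟨hG⟩ := hG Y f c hc hM
  obtain ⟨hH⟩ := hH Y f c hc hM
  exact nonempty_isColimit_mapCocone_of_isPushout (c := (overToArrow Y).mapCocone c) hP hF hG hH

theorem of_comp_leftFunc (hα : α ≠ 0) {T : Arrow C ⥤ Arrow C}
    (hT : ∀ {f g : Arrow C} (a : f ⟶ g), IsIso a.right → IsIso (T.map a).right)
    (hE : PreservesMColimits M α (T ⋙ Arrow.leftFunc)) : PreservesMColimits M α T := by
  intro Y f c hc hM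
  obtain ⟨hl⟩ := hE Y f c hc hM
  have : Nonempty α.ord.ToType := by
    rwa [Ordinal.nonempty_toType_iff, Ne, Cardinal.ord_eq_zero]
  have := IsFiltered.isConnected α.ord.ToType
  have (j : α.ord.ToType) : IsIso ((T.map ((overToArrow Y).map (c.ι.app j))).right) :=
    hT _ (inferInstanceAs (IsIso (𝟙 Y)))
  have : IsIso ((Comma.snd _ _).mapCocone ((overToArrow Y ⋙ T).mapCocone c)).ι :=
    @NatIso.isIso_of_isIso_app _ _ _ _ _ _ _ this
  exact ⟨Comma.fstSndJointlyReflectColimit hl (isColimitOfIsIso _)⟩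

end PreservesMColimits

end PreservesMColimits

/-! ## Cole's functors -/

section ColeFunctors

variable {V : Type u'} [Category.{v'} V] [CartesianMonoidalCategory V] [MonoidalClosed V]
variable (C : Type u) [Category.{v} C] [EnrichedOrdinaryCategory V C] [Tensored V C]

/-- The functor `X ↦ X ⊗ K`. -/
def tensorFunctor (K : V) : C ⥤ C where
  obj X := Tensored.obj X K
  map f := tensorMap K f
  map_id := tensorMap_id K
  map_comp := tensorMap_comp K

instance isLeftAdjoint_tensorFunctor [Cotensored V C] (K : V) :
    (tensorFunctor C K).IsLeftAdjoint := by
  let e (X Y : C) : (Tensored.obj X K ⟶ Y) ≃ (X ⟶ Cotensored.obj K Y) :=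
    (tensorEquiv X K Y).trans (cotensorEquiv K X Y).symm
  have he {X' X Y : C} (f : X' ⟶ X) (g : Tensored.obj X K ⟶ Y) :
      e X' Y (tensorMap K f ≫ g) = f ≫ e X Y g := by
    have h : tensorMap K f ≫ (e X Y).symm (e X Y g) = (e X' Y).symm (f ≫ e X Y g) ≫ 𝟙 Y :=
      adjunct_naturality _ _ _ _ (by rw [cotensorMap_id, Category.comp_id])
    rwa [Category.comp_id, Equiv.symm_apply_apply, Equiv.eq_symm_apply] at h
  exact (Adjunction.adjunctionOfEquivRight (F := tensorFunctor C K) e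
    fun _ _ _ => he).isLeftAdjoint

variable {C} [Cotensored V C] [HasPullbacks C] [HasPushouts C] {I : V}
  (t : 𝟙_ V ⟶ I)

/-- The coprojection `N f ⊗ I ⟶ E f`. -/
def coleCylinder (f : Arrow C) : Tensored.obj ((mappingPath C t).obj f) I ⟶ (coleE C t).obj f :=
  pushout.inr (mappingPathFst t f) (tensorPoint t ((mappingPath C t).obj f))

lemma coleCylinder_naturality {f g : Arrow C} (a : f ⟶ g) :
    coleCylinder t f ≫ (coleE C t).map a =
      tensorMap I ((mappingPath C t).map a) ≫ coleCylinder t g :=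
  pushout.inr_desc _ _ _

lemma isPushout_coleE (f : Arrow C) :
    IsPushout (mappingPathFst t f) (tensorPoint t ((mappingPath C t).obj f)) (coleLeft t f)
      (coleCylinder t f) :=
  IsPushout.of_hasPushout _ _

variable {M : MorphismProperty C} {α : Cardinal.{v}}

theorem preservesMColimits_coleE (h : PreservesMColimits M α (mappingPath C t)) :
    PreservesMColimits M α (coleE C t) := by
  let φ : mappingPath C t ⟶ Arrow.leftFunc :=
    { app f := mappingPathFst t f, naturality f g a := mappingPathFst_naturality t a }
  let i₀ : mappingPath C t ⟶ mappingPath C t ⋙ tensorFunctor C I :=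
    { app f := tensorPoint t _, naturality f g a := tensorPoint_naturality t _ }
  let l : Arrow.leftFunc ⟶ coleE C t :=
    { app f := coleLeft t f, naturality f g a := (coleLeft_naturality t a).symm }
  let k : mappingPath C t ⋙ tensorFunctor C I ⟶ coleE C t :=
    { app f := coleCylinder t f, naturality f g a := (coleCylinder_naturality t a).symm }
  exact .of_isPushout (a := φ) (b := i₀) (g := l) (h := k) (isPushout_coleE t) h
    preservesMColimits_leftFunc (h.comp _)

theorem preservesMColimits_coleR (hα : α ≠ 0) (h : PreservesMColimits M α (mappingPath C t)) :
    PreservesMColimits M α (coleR C t) :=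
  .of_comp_leftFunc hα (fun _ ha => ha) (preservesMColimits_coleE t h)

end ColeFunctors

end Hurewicz

end

open Hurewicz in
theorem mainTheorem6_general {V : Type u'} [Category.{v'} V] [CartesianMonoidalCategory V]
    [MonoidalClosed V] {C : Type u} [Category.{v} C] [HasPullbacks C] [HasColimits C]
    [EnrichedOrdinaryCategory V C] [Tensored V C] [Cotensored V C]
    {I : V} (t : 𝟙_ V ⟶ I) {E M : MorphismProperty C}
    (hEM : IsOrthogonalFactorizationSystem E M) (hE : IsWellCopowered E)
    (hN : MonomorphismHypothesis M (mappingPath C t)) :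
    (∀ α : Cardinal.{v}, α ≠ 0 → PreservesMColimits M α (mappingPath C t) →
      PreservesMColimits M α (coleE C t) ∧ PreservesMColimits M α (coleR C t)) ∧
    SmallnessCondition (coleR C t) ∧
    FreeMonadExistsConstructively (coleR C t) (coleUnit C t) := by
  have hR : SmallnessCondition (coleR C t) := by
    obtain ⟨α, hα, h⟩ := hN
    exact ⟨E, M, hEM, hE, α, hα, preservesMColimits_coleR t hα.ne_zero h⟩
  exact ⟨fun α hα h => ⟨preservesMColimits_coleE t h, preservesMColimits_coleR t hα h⟩, hR,
    hR.freeMonadExistsConstructively fun f => inferInstanceAs (IsIso (𝟙 f.right))⟩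

theorem mainTheorem6
    (P : ObjectProperty TopCat.{v}) (hI : P TopCat.I)
    [CartesianMonoidalCategory P.FullSubcategory] [MonoidalClosed P.FullSubcategory]
    {C : Type u} [Category.{v} C] [HasLimits C] [HasColimits C]
    [EnrichedOrdinaryCategory P.FullSubcategory C]
    [Hurewicz.Tensored P.FullSubcategory C] [Hurewicz.Cotensored P.FullSubcategory C]
    (E M : MorphismProperty C) (hEM : Hurewicz.IsOrthogonalFactorizationSystem E M)
    (hE : Hurewicz.IsWellCopowered E)
    (hN : Hurewicz.MonomorphismHypothesis M
      (Hurewicz.mappingPath C (Hurewicz.intervalZero P hI))) :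
    (∀ α : Cardinal.{v}, α.IsRegular →
      Hurewicz.PreservesMColimits M α
        (Hurewicz.mappingPath C (Hurewicz.intervalZero P hI)) →
      Hurewicz.PreservesMColimits M α (Hurewicz.coleE C (Hurewicz.intervalZero P hI)) ∧
      Hurewicz.PreservesMColimits M α (Hurewicz.coleR C (Hurewicz.intervalZero P hI))) ∧
    Hurewicz.SmallnessCondition (Hurewicz.coleR C (Hurewicz.intervalZero P hI)) ∧
    Hurewicz.FreeMonadExistsConstructively (Hurewicz.coleR C (Hurewicz.intervalZero P hI))
      (Hurewicz.coleUnit C (Hurewicz.intervalZero P hI)) := by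
  obtain ⟨h, hR⟩ := mainTheorem6_general (Hurewicz.intervalZero P hI) hEM hE hN
  exact ⟨fun α hα => h α hα.ne_zero, hR⟩
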